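/- A $3$-graph on a vertex set $V$ is a collection of $3$-element subsets (edges) of $V$. Let $F_5$ be the $3$-graph on $\{a,b,c,d,e\}$ with edges $abc, abd, cde$, and let $M_{s+1}^3$ be the $3$-graph consisting of $s+1$ pairwise disjoint edges. A $3$-graph is $\{F_5,M_{s+1}^3\}$-free if it contains neither $F_5$ nor $M_{s+1}^3$ as a (not necessarily induced) subgraph; so being $M_{s+1}^3$-free means having matching number at most $s$. Let $\mathrm{ex}_3(n,\{F_5,M_{s+1}^3\})$ be the maximum number of edges of an $\{F_5,M_{s+1}^3\}$-free $3$-graph on $n$ vertices. The full star of center $x\in[n]$ is the $3$-graph of all $3$-subsets of $[n]$ that contain $x$. Let $\mathcal{H}_3(n,s)$ be the complete $3$-partite $3$-graph on $n$ vertices with partite sets of sizes $s$, $\lfloor (n-s)/2\rfloor$ and $\lceil (n-s)/2\rceil$: its edges are all triples with exactly one vertex in each partite set. Theorem. Let $s\ge 1$ and $n\geq 30(s+1)$ be integers. Then \[ \mathrm{ex}_3(n,\{F_5,M_{s+1}^3\})=\begin{cases}\binom{n-1}{2}, & s=1,2,\\[3pt] s\left\lfloor\frac{(n-s)^2}{4}\right\rfloor,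 & s\ge 3.\end{cases} \] Moreover, an $\{F_5,M_{s+1}^3\}$-free $3$-graph on $[n]$ attains this maximum if and only if it is a full star (of some center $x\in[n]$) when $s=1,2$, and if and only if it is isomorphic to $\mathcal{H}_3(n,s)$ when $s\geq 3$. In particular, the extremal $3$-graph is unique up to isomorphism. -/

import Mathlib

/-- An `r`-graph on the vertex set `V`: a finite collection of `r`-element subsets of `V`. -/
@[ext]
structure RGraph (r : ℕ) (V : Type) where
  edges : Finset (Finset V)
  uniform : ∀ e ∈ edges, e.card = r

namespace RGraph

/-- `H` contains `F` as a (not necessarily induced) subgraph. -/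
def Contains {r : ℕ} {V W : Type} (H : RGraph r V) (F : RGraph r W) : Prop :=
  ∃ f : W ↪ V, ∀ e ∈ F.edges, e.map f ∈ H.edges

/-- `H` contains no member of the family `ℱ` as a subgraph. -/
def IsFree {r : ℕ} {V : Type} (H : RGraph r V) (ℱ : Set (Σ W : Type, RGraph r W)) : Prop :=
  ∀ F ∈ ℱ, ¬ H.Contains F.2

/-- `H` and `H'` are isomorphic: a bijection of the vertex sets carries the edges of `H` exactly to
the edges of `H'`. -/
def IsIsomorphic {r : ℕ} {V W : Type} (H : RGraph r V) (H' : RGraph r W) : Prop :=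
  ∃ φ : V ≃ W, ∀ e : Finset V, e ∈ H.edges ↔ e.map φ.toEmbedding ∈ H'.edges

/-- The Turán number `ex_r(n, ℱ)`: the maximum number of edges of an `ℱ`-free `r`-graph on
`n` vertices. -/
noncomputable def turanNumber (r n : ℕ) (ℱ : Set (Σ W : Type, RGraph r W)) : ℕ :=
  sSup {m : ℕ | ∃ H : RGraph r (Fin n), H.IsFree ℱ ∧ H.edges.card = m}

/-- The generalized triangle `F₅` with edges `abc`, `abd`, `cde`. -/
def F5 : RGraph 3 (Fin 5) where
  edges := {{0, 1, 2}, {0, 1, 3}, {2, 3, 4}}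
  uniform := by decide

/-- The matching `M_k^r`: `k` pairwise disjoint edges `{i} × {0, …, r - 1}` of size `r`. -/
def matching (r k : ℕ) : RGraph r (Fin k × Fin r) where
  edges := Finset.univ.image fun i : Fin k => ({i} : Finset (Fin k)) ×ˢ (Finset.univ : Finset (Fin r))
  uniform := by
    intro e he
    obtain ⟨i, -, rfl⟩ := Finset.mem_image.1 he
    simp

/-- The full star of center `x`: all `r`-subsets of `V` that contain `x`. -/
def fullStar (r : ℕ) {V : Type} [Fintype V] [DecidableEq V] (x : V) : RGraph r V where
  edges := (Finset.univ.powersetCard r).filter fun e => x ∈ e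
  uniform := fun _ he => (Finset.mem_powersetCard.1 (Finset.mem_filter.1 he).1).2

open Classical in
/-- The complete multipartite `r`-graph whose partite sets are the fibres of `c : V → ι`: the edges
are all `r`-subsets of `V` that meet every partite set in at most one vertex. -/
noncomputable def completePartite (r : ℕ) {V ι : Type} [Fintype V] (c : V → ι) : RGraph r V where
  edges := (Finset.univ.powersetCard r).filter fun e => Set.InjOn c (e : Set V)
  uniform := fun _ he => (Finset.mem_powersetCard.1 (Finset.mem_filter.1 he).1).2

/-- `ℋ₃(n, s)`: the complete `3`-partite `3`-graph on `n` vertices with partite sets of sizes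
`s`, `⌊(n - s) / 2⌋` and `⌈(n - s) / 2⌉` (used for `s ≤ n`). -/
noncomputable def H3 (n s : ℕ) : RGraph 3 (Fin n) :=
  completePartite 3 fun i : Fin n =>
    if i.val < s then (0 : Fin 3) else if i.val < s + (n - s) / 2 then 1 else 2

/-- The family `{F₅, M_{s+1}^3}`. -/
def forbidden (s : ℕ) : Set (Σ W : Type, RGraph 3 W) :=
  {⟨Fin 5, F5⟩, ⟨Fin (s + 1) × Fin 3, matching 3 (s + 1)⟩}

end RGraph

namespace RGraph

open Finset

/-! ### Degrees, matchings and heavy vertices in an F₅-free triple system. -/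

section Combinatorics

variable {V : Type*} [DecidableEq V]

/-! Write n for the number of vertices and call a vertex heavy if its degree exceeds s(n-1); let S
be the set of heavy vertices. In an F₅-free system at most n-1 edges through a vertex x meet a given
edge avoiding x (`card_star_meeting_le`). Hence a matching that avoids S can be extended greedily by
one edge at each heavy vertex, so |S| ≤ s, and the edges disjoint from S have matching number at
most s-|S|. As their degrees are at most s(n-1), there are at most 3(s-|S|)s(n-1) of them, which is
linear in n for fixed s.

The edges with exactly one vertex in S carry the quadratic term. Colour each pair uv outside S by
the set of x in S with xuv an edge. F₅-freeness says that a colour common to two sides of a triangle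
is the only colour possible on the third side, so a triangle with three nonempty colour sets has at
most max(|S|, 3) colours in total. The weighted Mantel theorem `sum_pairs_le` then bounds these
edges by |S|⌊(n-|S|)²/4⌋ if |S| ≥ 3, and by 2⌊(n-|S|)²/4⌋ if |S| ≤ 2.

Edges with at least two vertices in S are paid for by lost colours. An edge prz with p, r in S
prevents any pair uv avoiding z from having both colours p and r. With q disjoint such pairs the
Mantel bound drops by about q(n-|S|)²/4 (`card_outer_le_of_hasPairs`), while a suitable q leaves
only O(q|S|n) such edges (`exists_hasPairs`). For s ≥ 3 and n ≥ 30(s+1), an extremal system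
therefore has |S| = s and every edge meets S exactly once; the equality case of Mantel makes it
complete tripartite and balanced outside S.

For s ≤ 2 the star wins, because triangles all of whose sides have the same single colour are
allowed. There the edges are shown either to be covered by one or two vertices, or to be too few. In
the two-vertex case `star_of_cover` shows that every pair outside has exactly one colour, and
F₅-freeness makes that colour constant. -/

/-- The family `E` of triples contains no three triples `abc`, `abd`, `cde` with `e ≠ a, b`. -/
def NoF5 (E : Finset (Finset V)) : Prop :=
  ∀ a b c d e : V, ({a, b, c} : Finset V) ∈ E → ({a, b, d} : Finset V) ∈ E →
    ({c, d, e} : Finset V) ∈ E → e = a ∨ e = b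

theorem triple_swap (a b c : V) : ({a, b, c} : Finset V) = {a, c, b} := by
  ext; simp; tauto

theorem triple_rotate (a b c : V) : ({a, b, c} : Finset V) = {b, c, a} := by
  ext; simp; tauto

theorem ne_of_triple_card {a b c : V} (h : ({a, b, c} : Finset V).card = 3) :
    a ≠ b ∧ a ≠ c ∧ b ≠ c := by
  refine ⟨?_, ?_, ?_⟩ <;> rintro rfl
  · have := card_le_two (a := a) (b := c); simp at h; omega
  · have := card_le_two (a := a) (b := b)
    rw [triple_swap] at h; simp at h; omega
  · have := card_le_two (a := a) (b := b); simp at h; omega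

theorem exists_triple_of_mem {e : Finset V} (he : e.card = 3) {x : V} (hx : x ∈ e) :
    ∃ y z, e = {x, y, z} := by
  have h : (e.erase x).card = 2 := by rw [card_erase_of_mem hx, he]
  obtain ⟨y, z, -, hyz⟩ := card_eq_two.1 h
  exact ⟨y, z, by rw [← insert_erase hx, hyz]⟩

theorem exists_triple_of_mem_of_mem {e : Finset V} (he : e.card = 3) {x y : V} (hx : x ∈ e)
    (hy : y ∈ e) (hxy : x ≠ y) : ∃ z, e = {x, y, z} := by
  obtain ⟨u, v, rfl⟩ := exists_triple_of_mem he hx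
  simp only [mem_insert, mem_singleton] at hy
  rcases hy with rfl | rfl | rfl
  · exact absurd rfl hxy
  · exact ⟨v, rfl⟩
  · exact ⟨u, triple_swap _ _ _⟩

theorem card_codegree_le {E : Finset (Finset V)} (hE : ∀ e ∈ E, e.card = 3) {U : Finset V}
    (hU : ∀ e ∈ E, e ⊆ U) {x y : V} (hxy : x ≠ y) :
    (E.filter fun e => x ∈ e ∧ y ∈ e).card ≤ (U \ {x, y}).card := by
  refine le_trans (card_le_card (t := (U \ {x, y}).image fun z => {x, y, z}) ?_) card_image_le
  intro e he
  obtain ⟨he, hx, hy⟩ := mem_filter.1 he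
  obtain ⟨z, rfl⟩ := exists_triple_of_mem_of_mem (hE e he) hx hy hxy
  obtain ⟨-, h1, h2⟩ := ne_of_triple_card (hE _ he)
  exact mem_image.2 ⟨z, by simp [hU _ he (show z ∈ _ by simp), h1.symm, h2.symm], rfl⟩

/-- If z lies outside m and x, then z is on at most one edge xpz with p in m: two of them together
with m form F₅. Charge that edge to z, and charge x together with two vertices of m to the third
vertex of m. Each vertex other than x is charged at most once. -/
theorem card_star_meeting_le {E : Finset (Finset V)} (hE : ∀ e ∈ E, e.card = 3) (hF : NoF5 E)
    {U : Finset V} (hU : ∀ e ∈ E, e ⊆ U) {x : V} (hxU : x ∈ U) {m : Finset V} (hm : m ∈ E)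
    (hx : x ∉ m) :
    (E.filter fun e => x ∈ e ∧ ¬ Disjoint e m).card ≤ U.card - 1 := by
  obtain ⟨a, b, c, hab, hac, hbc, rfl⟩ := card_eq_three.1 (hE m hm)
  rw [← card_erase_of_mem hxU]
  -- The inverse of the charging: `f z` is the only edge that can be charged to z.
  let f : V → Finset V := fun z =>
    if z ∈ ({a, b, c} : Finset V) then insert x (({a, b, c} : Finset V).erase z)
    else if ({x, a, z} : Finset V) ∈ E then {x, a, z}
    else if ({x, b, z} : Finset V) ∈ E then {x, b, z} else {x, c, z}
  refine le_trans (card_le_card (t := (U.erase x).image f) ?_) card_image_le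
  intro e hfe
  obtain ⟨he, hxe, hd⟩ := mem_filter.1 hfe
  clear hfe
  obtain ⟨p, hpe, hp⟩ := not_disjoint_iff.1 hd
  have hxp : x ≠ p := fun h => hx (h ▸ hp)
  obtain ⟨z, rfl⟩ := exists_triple_of_mem_of_mem (hE e he) hxe hpe hxp
  obtain ⟨-, hxz, hpz⟩ := ne_of_triple_card (hE _ he)
  have hmU := hU _ hm
  by_cases hz : z ∈ ({a, b, c} : Finset V)
  · obtain ⟨w, hw⟩ := exists_triple_of_mem_of_mem (hE _ hm) hp hz hpz
    obtain ⟨-, hpw, hzw⟩ := ne_of_triple_card (hw ▸ hE _ hm)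
    have hwm : w ∈ ({a, b, c} : Finset V) := by rw [hw]; simp
    refine mem_image.2 ⟨w, mem_erase.2 ⟨fun h => hx (h ▸ hwm), hmU hwm⟩, ?_⟩
    simp only [f, if_pos hwm]
    rw [hw]
    congr 1
    ext t
    simp only [mem_erase, mem_insert, mem_singleton]
    constructor
    · tauto
    · rintro (rfl | rfl) <;> tauto
  · refine mem_image.2 ⟨z, mem_erase.2 ⟨hxz.symm, hU _ he (by simp)⟩, ?_⟩
    simp only [f, if_neg hz]
    simp only [mem_insert, mem_singleton, not_or] at hz hx hp
    have key : ∀ u v w : V, ({u, v, w} : Finset V) ∈ E → w ≠ x → w ≠ z →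
        ({x, u, z} : Finset V) ∈ E → ({x, v, z} : Finset V) ∈ E → False := by
      intro u v w huvw hwx hwz hu hv
      rw [triple_swap] at hu hv
      rcases hF x z u v w hu hv huvw with h | h
      · exact hwx h
      · exact hwz h
    rcases hp with rfl | rfl | rfl
    · rw [if_pos he]
    · rw [if_neg, if_pos he]
      exact fun h => key _ _ _ hm (Ne.symm hx.2.2) (Ne.symm hz.2.2) h he
    · rw [if_neg, if_neg]
      · exact fun h => key _ _ _ (by rwa [triple_rotate] at hm) (Ne.symm hx.1) (Ne.symm hz.1) h he
      · exact fun h => key _ _ _ (by rwa [triple_swap] at hm) (Ne.symm hx.2.1) (Ne.symm hz.2.1) h he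

/-- Vertices of large degree can be covered one by one by edges that extend a given matching. -/
theorem exists_matching_extend [Fintype V] {E : Finset (Finset V)} (hE : ∀ e ∈ E, e.card = 3)
    (hF : NoF5 E) {s : ℕ} (D : Finset V) :
    ∀ M : Finset (Finset V), M ⊆ E → (M : Set (Finset V)).PairwiseDisjoint id →
      (∀ e ∈ M, Disjoint e D) →
      (∀ x ∈ D, s * (Fintype.card V - 1) < (E.filter fun e => x ∈ e).card) →
      M.card + D.card ≤ s + 1 →
      ∃ M' ⊆ E, (M' : Set (Finset V)).PairwiseDisjoint id ∧ M'.card = M.card + D.card := by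
  induction D using Finset.induction_on with
  | empty => exact fun M hM hd _ _ _ => ⟨M, hM, hd, by simp⟩
  | insert x D hxD ih =>
    intro M hM hd hMD hdeg hcard
    rw [card_insert_of_notMem hxD] at hcard
    obtain ⟨e, heE, hxe, heM, heD⟩ :
        ∃ e ∈ E, x ∈ e ∧ (∀ m ∈ M, Disjoint e m) ∧ Disjoint e D := by
      -- Every edge at x would meet an edge of M or another vertex of D. Each of these at most s
      -- obstacles blocks at most n-1 edges at x, fewer than its degree.
      by_contra! hcon
      have hsub : (E.filter fun e => x ∈ e) ⊆
          (M.biUnion fun m => E.filter fun e => x ∈ e ∧ ¬ Disjoint e m) ∪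
            D.biUnion fun y => E.filter fun e => x ∈ e ∧ y ∈ e := by
        intro e he
        obtain ⟨he, hxe⟩ := mem_filter.1 he
        by_cases h : ∀ m ∈ M, Disjoint e m
        · obtain ⟨y, hy, hyD⟩ := not_disjoint_iff.1 (hcon e he hxe h)
          exact mem_union_right _ (mem_biUnion.2 ⟨y, hyD, mem_filter.2 ⟨he, hxe, hy⟩⟩)
        · push Not at h
          obtain ⟨m, hm, hem⟩ := h
          exact mem_union_left _ (mem_biUnion.2 ⟨m, hm, mem_filter.2 ⟨he, hxe, hem⟩⟩)
      have h1 := (card_le_card hsub).trans (card_union_le _ _)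
      have h2 : (M.biUnion fun m => E.filter fun e => x ∈ e ∧ ¬ Disjoint e m).card ≤
          M.card * (Fintype.card V - 1) := by
        refine card_biUnion_le_card_mul _ _ _ fun m hm => ?_
        exact card_star_meeting_le hE hF (U := univ) (fun _ _ => subset_univ _) (mem_univ x) (hM hm)
          (fun hxm => disjoint_left.1 (hMD m hm) hxm (mem_insert_self _ _))
      have h3 : (D.biUnion fun y => E.filter fun e => x ∈ e ∧ y ∈ e).card ≤
          D.card * (Fintype.card V - 1) := by
        refine card_biUnion_le_card_mul _ _ _ fun y hy => ?_
        have hxy : x ≠ y := fun h => hxD (h ▸ hy)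
        refine (card_codegree_le hE (U := univ) (fun _ _ => subset_univ _)
          hxy).trans ?_
        rw [card_sdiff_of_subset (subset_univ _), card_univ, card_pair hxy]
        omega
      have h4 := hdeg x (mem_insert_self _ _)
      have h5 : (M.card + D.card) * (Fintype.card V - 1) ≤ s * (Fintype.card V - 1) :=
        Nat.mul_le_mul_right _ (by omega)
      rw [add_mul] at h5
      omega
    have heM' : e ∉ M := fun h => disjoint_left.1 (heM e h) hxe hxe
    obtain ⟨M', h1, h2, h3⟩ := ih (insert e M) (insert_subset heE hM) (by
        rw [coe_insert]
        exact hd.insert fun m hm _ => heM m hm)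
      (by
        intro m hm
        rcases mem_insert.1 hm with rfl | hm
        · exact heD
        · exact (hMD m hm).mono_right (subset_insert _ _))
      (fun y hy => hdeg y (mem_insert_of_mem hy)) (by rw [card_insert_of_notMem heM']; omega)
    refine ⟨M', h1, h2, ?_⟩
    rw [h3, card_insert_of_notMem heM', card_insert_of_notMem hxD]
    omega

theorem exists_maximal_matching (R : Finset (Finset V)) :
    ∃ M ⊆ R, (M : Set (Finset V)).PairwiseDisjoint id ∧ ∀ e ∈ R, e.Nonempty → ∃ m ∈ M, ¬ Disjoint e m := by
  classical
  obtain ⟨M, hM, hmax⟩ := exists_max_image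
    (R.powerset.filter fun M : Finset (Finset V) => (M : Set (Finset V)).PairwiseDisjoint id) card
    ⟨∅, by simp⟩
  obtain ⟨hMR, hMd⟩ := mem_filter.1 hM
  refine ⟨M, mem_powerset.1 hMR, hMd, fun e he hne => ?_⟩
  by_contra! hcon
  have heM : e ∉ M := fun h => hne.ne_empty (disjoint_self.1 (hcon e h))
  have := hmax (insert e M) (mem_filter.2 ⟨mem_powerset.2 (insert_subset he (mem_powerset.1 hMR)), by
    rw [coe_insert]
    exact hMd.insert fun m hm _ => hcon m hm⟩)
  rw [card_insert_of_notMem heM] at this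
  omega

/-- A triple system of small matching number and small maximum degree is small. -/
theorem card_le_of_degree_le {R : Finset (Finset V)} (hR : ∀ e ∈ R, e.card = 3) {t d : ℕ}
    (hν : ∀ M ⊆ R, (M : Set (Finset V)).PairwiseDisjoint id → M.card ≤ t)
    (hd : ∀ x : V, ∀ e ∈ R, x ∈ e → (R.filter fun e => x ∈ e).card ≤ d) : R.card ≤ 3 * t * d := by
  obtain ⟨M, hMR, hMd, hmax⟩ := exists_maximal_matching R
  -- The vertices of a maximal matching, at most 3t of them, meet every edge.
  have hsub : R ⊆ (M.biUnion id).biUnion fun x => R.filter fun e => x ∈ e := by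
    intro e he
    obtain ⟨m, hm, hem⟩ := hmax e he (card_pos.1 (by rw [hR e he]; norm_num))
    obtain ⟨x, hxe, hxm⟩ := not_disjoint_iff.1 hem
    exact mem_biUnion.2 ⟨x, mem_biUnion.2 ⟨m, hm, hxm⟩, mem_filter.2 ⟨he, hxe⟩⟩
  have h1 : (M.biUnion id).card ≤ M.card * 3 :=
    card_biUnion_le_card_mul _ _ _ fun m hm => (hR m (hMR hm)).le
  have h2 : R.card ≤ (M.biUnion id).card * d := by
    refine (card_le_card hsub).trans (card_biUnion_le_card_mul _ _ _ fun x hx => ?_)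
    obtain ⟨m, hm, hxm⟩ := mem_biUnion.1 hx
    exact hd x m (hMR hm) hxm
  have h3 := hν M hMR hMd
  calc R.card ≤ (M.biUnion id).card * d := h2
    _ ≤ (3 * t) * d := Nat.mul_le_mul_right _ (by omega)

/-- The vertices of degree larger than `s (|V| - 1)`. -/
def heavy [Fintype V] (E : Finset (Finset V)) (s : ℕ) : Finset V :=
  univ.filter fun x => s * (Fintype.card V - 1) < (E.filter fun e => x ∈ e).card

variable [Fintype V] {E : Finset (Finset V)} {s : ℕ}

/-- Otherwise add edges at s+1-|M| heavy vertices to M and obtain a matching of size s+1. -/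
theorem card_add_card_heavy_le (hE : ∀ e ∈ E, e.card = 3) (hF : NoF5 E)
    (hν : ∀ M ⊆ E, (M : Set (Finset V)).PairwiseDisjoint id → M.card ≤ s)
    {M : Finset (Finset V)} (hM : M ⊆ E) (hd : (M : Set (Finset V)).PairwiseDisjoint id)
    (hMS : ∀ e ∈ M, Disjoint e (heavy E s)) : M.card + (heavy E s).card ≤ s := by
  by_contra! hcon
  have hMs := hν M hM hd
  obtain ⟨D, hD, hDcard⟩ := exists_subset_card_eq (s := heavy E s) (n := s + 1 - M.card) (by omega)
  obtain ⟨M', h1, h2, h3⟩ := exists_matching_extend hE hF (s := s) D M hM hd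
    (fun e he => (hMS e he).mono_right hD) (fun x hx => (mem_filter.1 (hD hx)).2) (by omega)
  have := hν M' h1 h2
  omega

theorem card_heavy_le (hE : ∀ e ∈ E, e.card = 3) (hF : NoF5 E)
    (hν : ∀ M ⊆ E, (M : Set (Finset V)).PairwiseDisjoint id → M.card ≤ s) :
    (heavy E s).card ≤ s := by
  simpa using card_add_card_heavy_le hE hF hν (M := ∅) (by simp) (by simp) (by simp)

theorem card_disjoint_heavy_le (hE : ∀ e ∈ E, e.card = 3) (hF : NoF5 E)
    (hν : ∀ M ⊆ E, (M : Set (Finset V)).PairwiseDisjoint id → M.card ≤ s) :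
    (E.filter fun e => Disjoint e (heavy E s)).card ≤
      3 * (s - (heavy E s).card) * (s * (Fintype.card V - 1)) := by
  refine card_le_of_degree_le (fun e he => hE e (mem_filter.1 he).1) ?_ ?_
  · intro M hM hd
    have := card_add_card_heavy_le hE hF hν (hM.trans (filter_subset _ _)) hd
      (fun e he => (mem_filter.1 (hM he)).2)
    omega
  · intro x e he hxe
    have hx : x ∉ heavy E s := fun h => disjoint_left.1 (mem_filter.1 he).2 hxe h
    simp only [heavy, mem_filter, mem_univ, true_and, not_lt] at hx
    exact (card_le_card (filter_subset_filter _ (filter_subset _ _))).trans hx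

end Combinatorics

/-! ### A weighted Mantel theorem and its equality case. -/

section WeightedMantel

variable {V : Type*} [DecidableEq V] {w : V → V → ℕ}

theorem sum_pairs_insert_insert (hs : ∀ a b, w a b = w b a) (h0 : ∀ a, w a a = 0) {u v : V}
    {W : Finset V} (huv : u ≠ v) (hu : u ∉ W) (hv : v ∉ W) :
    ∑ a ∈ insert u (insert v W), ∑ b ∈ insert u (insert v W), w a b =
      ∑ a ∈ W, ∑ b ∈ W, w a b + 2 * w u v + 2 * ∑ z ∈ W, (w u z + w v z) := by
  have hu' : u ∉ insert v W := by simp [huv, hu]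
  simp only [sum_insert hu', sum_insert hv, sum_add_distrib, h0, hs v u]
  rw [sum_congr rfl (fun z _ => hs z u), sum_congr rfl (fun z _ => hs z v)]
  ring

theorem sq_div_four_add_two (N : ℕ) : (N + 2) ^ 2 / 4 = N ^ 2 / 4 + (N + 1) := by
  rw [show (N + 2) ^ 2 = N ^ 2 + 4 * (N + 1) by ring, Nat.add_mul_div_left _ _ (by norm_num)]

theorem mul_pred_le_four_mul_sq_div_four (N : ℕ) : N * (N - 1) ≤ 4 * (N ^ 2 / 4) := by
  rcases Nat.even_or_odd' N with ⟨k, rfl | rfl⟩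
  · rw [show (2 * k) ^ 2 = 4 * (k ^ 2) by ring, Nat.mul_div_cancel_left _ (by norm_num)]
    have : 2 * k * (2 * k - 1) ≤ 2 * k * (2 * k) := Nat.mul_le_mul_left _ (by omega)
    nlinarith
  · rw [show (2 * k + 1) ^ 2 = 1 + 4 * (k ^ 2 + k) by ring, Nat.add_mul_div_left _ _ (by norm_num)]
    simp only [add_tsub_cancel_right]
    norm_num
    nlinarith

theorem sum_pairs_le_mul_pred {c : ℕ} (h0 : ∀ a, w a a = 0) {W : Finset V}
    (hc : ∀ a ∈ W, ∀ b ∈ W, w a b ≤ c) :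
    ∑ a ∈ W, ∑ b ∈ W, w a b ≤ W.card * (W.card - 1) * c := by
  have : ∀ a ∈ W, ∑ b ∈ W, w a b ≤ (W.card - 1) * c := by
    intro a ha
    rw [← sum_erase (a := a) _ (h0 a), ← card_erase_of_mem ha]
    exact sum_le_card_nsmul _ _ _ fun b hb => hc a ha b (mem_of_mem_erase hb)
  calc _ ≤ W.card • ((W.card - 1) * c) := sum_le_card_nsmul _ _ _ this
    _ = _ := by rw [smul_eq_mul, mul_assoc]

/-- If one of the two weights is zero, the cap m on the other suffices; otherwise uvz is a triangle,
and K minus the weight of uv is at most m. -/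
theorem add_le_of_triangle {V : Type*} {w : V → V → ℕ} {m K : ℕ} {W : Finset V} (hm : ∀ a ∈ W, ∀ b ∈ W, w a b ≤ m)
    (hK : ∀ a ∈ W, ∀ b ∈ W, ∀ c ∈ W, 0 < w a b → 0 < w a c → 0 < w b c →
      w a b + w a c + w b c ≤ K) {u v z : V} (hu : u ∈ W) (hv : v ∈ W) (hz : z ∈ W)
    (huv : 0 < w u v) (hKuv : K ≤ w u v + m) : w u z + w v z ≤ m := by
  have h1 := hm u hu z hz
  have h2 := hm v hv z hz
  have h3 := hK u hu v hv z hz huv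
  omega

/-- Mantel's theorem for graphs with bounded edge weights and bounded triangle weights. -/
theorem sum_pairs_le {m K : ℕ} (hmK : 2 * K ≤ 3 * m) (hs : ∀ a b, w a b = w b a)
    (h0 : ∀ a, w a a = 0) (W : Finset V) (hm : ∀ a ∈ W, ∀ b ∈ W, w a b ≤ m)
    (hK : ∀ a ∈ W, ∀ b ∈ W, ∀ c ∈ W, 0 < w a b → 0 < w a c → 0 < w b c →
      w a b + w a c + w b c ≤ K) :
    ∑ a ∈ W, ∑ b ∈ W, w a b ≤ 2 * (m * (W.card ^ 2 / 4)) := by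
  induction hN : W.card using Nat.strong_induction_on generalizing W with
  | _ N ih =>
  -- Delete the ends of a sufficiently heavy edge: each other vertex loses at most m, as in the
  -- inductive proof of Mantel. If there is no such edge, all positive weights are below K - m ≤
  -- m/2, and the trivial bound over all pairs suffices.
  by_cases h : ∃ u ∈ W, ∃ v ∈ W, 0 < w u v ∧ K ≤ w u v + m
  · obtain ⟨u, hu, v, hv, hpos, hKuv⟩ := h
    have huv : u ≠ v := by rintro rfl; rw [h0] at hpos; omega
    obtain ⟨W', rfl, hu', hv'⟩ : ∃ W', W = insert u (insert v W') ∧ u ∉ W' ∧ v ∉ W' :=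
      ⟨(W.erase u).erase v, by
        rw [insert_erase (mem_erase.2 ⟨huv.symm, hv⟩), insert_erase hu], by simp, by simp⟩
    have hc : (insert u (insert v W')).card = W'.card + 2 := by
      rw [card_insert_of_notMem (by simp [huv, hu']), card_insert_of_notMem hv']
    have hsub : W' ⊆ insert u (insert v W') := (subset_insert _ _).trans (subset_insert _ _)
    have hrest := ih W'.card (by omega) W' (fun a ha b hb => hm a (hsub ha) b (hsub hb))
      (fun a ha b hb c hc => hK a (hsub ha) b (hsub hb) c (hsub hc)) rfl
    have hsum : ∑ z ∈ W', (w u z + w v z) ≤ W'.card * m :=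
      sum_le_card_nsmul _ _ _ fun z hz => add_le_of_triangle hm hK hu hv (hsub hz) hpos hKuv
    have hmuv := hm u hu v hv
    rw [sum_pairs_insert_insert hs h0 huv hu' hv', ← hN, hc, sq_div_four_add_two]
    nlinarith
  · push Not at h
    have h2 : ∀ a ∈ W, ∀ b ∈ W, 2 * w a b ≤ m := by
      intro a ha b hb
      have := h a ha b hb
      omega
    have h3 := sum_pairs_le_mul_pred (w := w) (c := m / 2) h0 (W := W) (fun a ha b hb => by
      have := h2 a ha b hb
      omega)
    have h4 := mul_pred_le_four_mul_sq_div_four W.card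
    rw [← hN]
    have h5 : W.card * (W.card - 1) * (m / 2) ≤ 4 * (W.card ^ 2 / 4) * (m / 2) :=
      Nat.mul_le_mul_right _ h4
    have h6 : 2 * (m / 2) ≤ m := Nat.mul_div_le m 2
    nlinarith [Nat.mul_le_mul_left (2 * (W.card ^ 2 / 4)) h6]

/-- Every positive edge of an extremal weighted graph is saturated. -/
theorem saturated_of_sum_pairs_eq {m : ℕ} (hs : ∀ a b, w a b = w b a)
    (h0 : ∀ a, w a a = 0) {W : Finset V} (hm : ∀ a ∈ W, ∀ b ∈ W, w a b ≤ m)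
    (hK : ∀ a ∈ W, ∀ b ∈ W, ∀ c ∈ W, 0 < w a b → 0 < w a c → 0 < w b c →
      w a b + w a c + w b c ≤ m)
    (heq : 2 * (m * (W.card ^ 2 / 4)) ≤ ∑ a ∈ W, ∑ b ∈ W, w a b) {u v : V} (hu : u ∈ W)
    (hv : v ∈ W) (hpos : 0 < w u v) :
    w u v = m ∧ ∀ z ∈ W, (w u z = 0 ∧ w v z = m) ∨ (w u z = m ∧ w v z = 0) := by
  have huv : u ≠ v := by rintro rfl; rw [h0] at hpos; omega
  obtain ⟨W', rfl, hu', hv'⟩ : ∃ W', W = insert u (insert v W') ∧ u ∉ W' ∧ v ∉ W' :=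
    ⟨(W.erase u).erase v, by
      rw [insert_erase (mem_erase.2 ⟨huv.symm, hv⟩), insert_erase hu], by simp, by simp⟩
  have hc : (insert u (insert v W')).card = W'.card + 2 := by
    rw [card_insert_of_notMem (by simp [huv, hu']), card_insert_of_notMem hv']
  have hsub : W' ⊆ insert u (insert v W') := (subset_insert _ _).trans (subset_insert _ _)
  have hrest := sum_pairs_le (K := m) (m := m) (by omega) hs h0 W'
    (fun a ha b hb => hm a (hsub ha) b (hsub hb))
    (fun a ha b hb c hc => hK a (hsub ha) b (hsub hb) c (hsub hc))
  have hle : ∀ z ∈ W', w u z + w v z ≤ m := fun z hz =>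
    add_le_of_triangle hm hK hu hv (hsub hz) hpos (by omega)
  have hsum : ∑ z ∈ W', (w u z + w v z) ≤ ∑ z ∈ W', m := sum_le_sum hle
  have hmuv := hm u hu v hv
  rw [sum_pairs_insert_insert hs h0 huv hu' hv', hc, sq_div_four_add_two] at heq
  have hconst : ∑ z ∈ W', m = W'.card * m := by simp
  -- Since K = m here, deleting any positive edge is a valid step of the induction, so equality must
  -- hold in each of its estimates.
  have hw : w u v = m := by nlinarith
  have hS : ∑ z ∈ W', (w u z + w v z) = ∑ z ∈ W', m := by nlinarith
  refine ⟨hw, fun z hz => ?_⟩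
  rcases mem_insert.1 hz with rfl | hz'
  · exact Or.inl ⟨h0 _, by rw [hs, hw]⟩
  rcases mem_insert.1 hz' with rfl | hz'
  · exact Or.inr ⟨hw, h0 _⟩
  have h1 := (sum_eq_sum_iff_of_le hle).1 hS z hz'
  have h2 := hK u hu v hv z hz hpos
  omega

end WeightedMantel

/-! ### Colour sets of pairs outside S. -/

section Colours

variable {V : Type*} [DecidableEq V]

/-- An element of two of the sets contains the third in its singleton, hence lies in all three, and
then all are that singleton. Otherwise the sets are disjoint in S. The two cases give 3 and |S|. -/
theorem card_add_card_add_card_le {S A B C : Finset V} (hA : A ⊆ S) (hB : B ⊆ S) (hC : C ⊆ S)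
    (hA0 : A.Nonempty) (hB0 : B.Nonempty) (hC0 : C.Nonempty)
    (hAB : ∀ i ∈ A, i ∈ B → C ⊆ {i}) (hAC : ∀ i ∈ A, i ∈ C → B ⊆ {i})
    (hBC : ∀ i ∈ B, i ∈ C → A ⊆ {i}) : A.card + B.card + C.card ≤ max S.card 3 := by
  by_cases h : ∃ i, i ∈ A ∧ i ∈ B ∧ i ∈ C
  · obtain ⟨i, ha, hb, hc⟩ := h
    have h1 := card_le_card (hAB i ha hb)
    have h2 := card_le_card (hAC i ha hc)
    have h3 := card_le_card (hBC i hb hc)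
    simp only [card_singleton] at h1 h2 h3
    omega
  · push Not at h
    have mem_of : ∀ {X : Finset V} {i : V}, X.Nonempty → X ⊆ {i} → i ∈ X := by
      rintro X i ⟨j, hj⟩ hX
      have := mem_singleton.1 (hX hj)
      rwa [← this]
    have dAB : Disjoint A B := disjoint_left.2 fun i ha hb =>
      h i ha hb (mem_of hC0 (hAB i ha hb))
    have dAC : Disjoint A C := disjoint_left.2 fun i ha hc =>
      h i ha (mem_of hB0 (hAC i ha hc)) hc
    have dBC : Disjoint B C := disjoint_left.2 fun i hb hc =>
      h i (mem_of hA0 (hBC i hb hc)) hb hc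
    rw [← card_union_of_disjoint dAB,
      ← card_union_of_disjoint (disjoint_union_left.2 ⟨dAC, dBC⟩)]
    exact (card_le_card (union_subset (union_subset hA hB) hC)).trans (le_max_left _ _)

/-- The vertices `x ∈ S` for which `xuv` is an edge. -/
def colours (E : Finset (Finset V)) (S : Finset V) (u v : V) : Finset V :=
  S.filter fun x => ({x, u, v} : Finset V) ∈ E

variable {E : Finset (Finset V)} {S : Finset V}

theorem colours_comm (u v : V) : colours E S u v = colours E S v u := by
  simp only [colours, triple_swap _ u v]

theorem colours_self (hE : ∀ e ∈ E, e.card = 3) (u : V) : colours E S u u = ∅ := by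
  refine filter_eq_empty_iff.2 fun x _ h => ?_
  exact (ne_of_triple_card (hE _ h)).2.2 rfl

/-- A colour j of vz gives the edges iuv, iuz, vzj, which form F₅ unless j is i or u; the latter is
not in S. -/
theorem colours_triangle (hF : NoF5 E) {u v z i : V} (hu : u ∉ S) (h1 : i ∈ colours E S u v)
    (h2 : i ∈ colours E S u z) : colours E S v z ⊆ {i} := by
  intro j hj
  obtain ⟨hjS, hj⟩ := mem_filter.1 hj
  rw [triple_rotate] at hj
  rcases hF i u v z j (mem_filter.1 h1).2 (mem_filter.1 h2).2 hj with h | h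
  · simp [h]
  · exact absurd (h ▸ hjS) hu

/-- A triangle with three nonempty sets of colours has few colours in total. -/
theorem triangle_card_le (hF : NoF5 E) {C : V → V → Finset V} (hC : ∀ u v, C u v ⊆ colours E S u v)
    (hs : ∀ u v, C u v = C v u) {u v z : V} (hu : u ∉ S) (hv : v ∉ S) (hz : z ∉ S)
    (huv : 0 < (C u v).card) (huz : 0 < (C u z).card) (hvz : 0 < (C v z).card) :
    (C u v).card + (C u z).card + (C v z).card ≤ max S.card 3 := by
  have hCS : ∀ u v, C u v ⊆ S := fun u v => (hC u v).trans (filter_subset _ _)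
  have key : ∀ {u v z i : V}, u ∉ S → i ∈ C u v → i ∈ C u z → C v z ⊆ {i} :=
    fun hu h1 h2 => (hC _ _).trans (colours_triangle hF hu (hC _ _ h1) (hC _ _ h2))
  refine card_add_card_add_card_le (hCS _ _) (hCS _ _) (hCS _ _) (card_pos.1 huv) (card_pos.1 huz)
    (card_pos.1 hvz) (fun i h1 h2 => key hu h1 h2) (fun i h1 h2 => ?_) (fun i h1 h2 => ?_)
  · exact key hv (hs u v ▸ h1) h2
  · exact key hz (hs u z ▸ h1) (hs v z ▸ h2)

/-- The sum runs over ordered pairs, so an edge xuv with only x in S is counted from (u, v) and from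
(v, u). -/
theorem two_mul_card_le_sum_colours [Fintype V] (hE : ∀ e ∈ E, e.card = 3) :
    2 * (E.filter fun e => (e ∩ S).card = 1).card ≤
      ∑ u ∈ Sᶜ, ∑ v ∈ Sᶜ, (colours E S u v).card := by
  let P : Finset (V × V × V) := (Sᶜ ×ˢ Sᶜ ×ˢ S).filter fun p => ({p.2.2, p.1, p.2.1} : Finset V) ∈ E
  have hP : P.card = ∑ u ∈ Sᶜ, ∑ v ∈ Sᶜ, (colours E S u v).card := by
    simp only [P, card_filter, sum_product, colours]
  rw [← hP]
  let g : V × V × V → Finset V := fun p => {p.2.2, p.1, p.2.1}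
  have hsub : (E.filter fun e => (e ∩ S).card = 1) ⊆ P.image g ∧
      ∀ e ∈ E, (e ∩ S).card = 1 → 2 ≤ (P.filter fun p => g p = e).card := by
    have main : ∀ e ∈ E, (e ∩ S).card = 1 → 2 ≤ (P.filter fun p => g p = e).card := by
      intro e he h1
      obtain ⟨x, hx⟩ := card_eq_one.1 h1
      have hxe := mem_inter.1 (hx ▸ mem_singleton_self x : x ∈ e ∩ S)
      obtain ⟨u, v, rfl⟩ := exists_triple_of_mem (hE e he) hxe.1
      obtain ⟨hxu, hxv, huv⟩ := ne_of_triple_card (hE _ he)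
      have hnot : ∀ t ∈ ({x, u, v} : Finset V), x ≠ t → t ∉ S := by
        intro t ht hxt htS
        have : t ∈ ({x} : Finset V) := hx ▸ mem_inter.2 ⟨ht, htS⟩
        exact hxt (mem_singleton.1 this).symm
      have huS := hnot u (by simp) hxu
      have hvS := hnot v (by simp) hxv
      refine one_lt_card.2 ⟨(u, v, x), ?_, (v, u, x), ?_, ?_⟩
      · simp [P, g, huS, hvS, hxe.2, he]
      · simp [P, g, huS, hvS, hxe.2, triple_swap x v u, he]
      · simp [huv]
    refine ⟨fun e he => ?_, main⟩
    obtain ⟨he, h1⟩ := mem_filter.1 he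
    obtain ⟨p, hp⟩ := card_pos.1 (show 0 < (P.filter fun p => g p = e).card by
      have := main e he h1; omega)
    obtain ⟨hp, hpe⟩ := mem_filter.1 hp
    exact mem_image.2 ⟨p, hp, hpe⟩
  calc 2 * (E.filter fun e => (e ∩ S).card = 1).card
      = ∑ e ∈ E.filter (fun e => (e ∩ S).card = 1), 2 := by simp [mul_comm]
    _ ≤ ∑ e ∈ E.filter (fun e => (e ∩ S).card = 1), (P.filter fun p => g p = e).card :=
      sum_le_sum fun e he => hsub.2 e (mem_filter.1 he).1 (mem_filter.1 he).2
    _ ≤ ∑ e ∈ P.image g, (P.filter fun p => g p = e).card := sum_le_sum_of_subset hsub.1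
    _ = P.card := (card_eq_sum_card_image g P).symm

theorem card_eq_add_add (E : Finset (Finset V)) (S : Finset V) :
    E.card = (E.filter fun e => (e ∩ S).card = 1).card +
      (E.filter fun e => 2 ≤ (e ∩ S).card).card + (E.filter fun e => Disjoint e S).card := by
  rw [card_eq_sum_ones E]
  simp only [card_filter, ← sum_add_distrib]
  refine sum_congr rfl fun e _ => ?_
  simp only [disjoint_iff_inter_eq_empty, ← card_eq_zero]
  split_ifs <;> omega

end Colours

/-! ### Edges with several vertices in S, and the colours they cost. -/

section Inner

variable {V : Type*} [DecidableEq V]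

/-- There are `q` disjoint pairs of vertices of `S`, each contained in an edge. -/
def HasPairs (E : Finset (Finset V)) (S : Finset V) (q : ℕ) : Prop :=
  ∃ p r z : Fin q → V, (∀ i, p i ∈ S ∧ r i ∈ S ∧ ({p i, r i, z i} : Finset V) ∈ E) ∧
    Function.Injective p ∧ Function.Injective r ∧ ∀ i j, p i ≠ r j

theorem exists_pair_of_two_le {S e : Finset V} (h : 2 ≤ (e ∩ S).card) :
    ∃ x ∈ S, ∃ y ∈ S, x ≠ y ∧ x ∈ e ∧ y ∈ e := by
  obtain ⟨x, hx, y, hy, hxy⟩ := one_lt_card.1 h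
  rw [mem_inter] at hx hy
  exact ⟨x, hx.2, y, hy.2, hxy, hx.1, hy.1⟩

variable [Fintype V] {E : Finset (Finset V)} {S : Finset V}

theorem card_inner_le (hE : ∀ e ∈ E, e.card = 3) {P : Finset V}
    (hP : ∀ e ∈ E, 2 ≤ (e ∩ S).card → ∃ x ∈ P, ∃ y ∈ S, x ≠ y ∧ x ∈ e ∧ y ∈ e) :
    (E.filter fun e => 2 ≤ (e ∩ S).card).card ≤ P.card * S.card * Fintype.card V := by
  have : (E.filter fun e => 2 ≤ (e ∩ S).card) ⊆
      (P ×ˢ S ×ˢ (univ : Finset V)).image fun p => {p.1, p.2.1, p.2.2} := by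
    intro e he
    obtain ⟨he, h2⟩ := mem_filter.1 he
    obtain ⟨x, hx, y, hy, hxy, hxe, hye⟩ := hP e he h2
    obtain ⟨z, rfl⟩ := exists_triple_of_mem_of_mem (hE e he) hxe hye hxy
    exact mem_image.2 ⟨(x, y, z), by simp [hx, hy], rfl⟩
  refine (card_le_card this).trans (card_image_le.trans ?_)
  rw [card_product, card_product, card_univ, mul_assoc]

theorem card_inner_le_sq (hE : ∀ e ∈ E, e.card = 3) :
    (E.filter fun e => 2 ≤ (e ∩ S).card).card ≤ S.card * S.card * Fintype.card V :=
  card_inner_le hE fun _ _ h => exists_pair_of_two_le h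

/-- Take q largest subject to q ≤ |S|/3. If the cap is reached, then |S| ≤ 3q+2 ≤ 5q and counting
all pairs in S is enough. Otherwise the family of pairs is maximal, so its 2q vertices meet every
pair of vertices of S that lies in an edge. The cap is what the weighted Mantel theorem needs later.
-/
theorem exists_hasPairs (hE : ∀ e ∈ E, e.card = 3) (hS : 3 ≤ S.card) :
    ∃ q, 3 * q ≤ S.card ∧ HasPairs E S q ∧
      (E.filter fun e => 2 ≤ (e ∩ S).card).card ≤ 5 * q * S.card * Fintype.card V := by
  classical
  have h0 : HasPairs E S 0 :=
    ⟨Fin.elim0, Fin.elim0, Fin.elim0, fun i => i.elim0, fun i => i.elim0, fun i => i.elim0,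
      fun i => i.elim0⟩
  set q := Nat.findGreatest (HasPairs E S) (S.card / 3) with hq
  have hq1 : HasPairs E S q := Nat.findGreatest_spec (Nat.zero_le _) h0
  have hq2 : q ≤ S.card / 3 := Nat.findGreatest_le _
  refine ⟨q, by omega, hq1, ?_⟩
  rcases hq2.eq_or_lt with h | h
  · refine (card_inner_le_sq hE).trans ?_
    have : S.card ≤ 5 * q := by omega
    gcongr
  · have hq3 : ¬ HasPairs E S (q + 1) := Nat.findGreatest_is_greatest (Nat.lt_succ_self _) h
    obtain ⟨p, r, z, hprz, hp, hr, hpr⟩ := hq1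
    have hP : (univ.image p ∪ univ.image r).card ≤ 5 * q := by
      refine (card_union_le _ _).trans ?_
      have h1 := card_image_le (s := (univ : Finset (Fin q))) (f := p)
      have h2 := card_image_le (s := (univ : Finset (Fin q))) (f := r)
      simp only [card_univ, Fintype.card_fin] at h1 h2
      omega
    refine (card_inner_le hE (P := univ.image p ∪ univ.image r) fun e he h2 => ?_).trans (by gcongr)
    obtain ⟨x, hx, y, hy, hxy, hxe, hye⟩ := exists_pair_of_two_le h2
    by_contra! hcon
    have hxP : x ∉ univ.image p ∪ univ.image r := fun h => hcon x h y hy hxy hxe hye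
    have hyP : y ∉ univ.image p ∪ univ.image r := fun h => hcon y h x hx hxy.symm hye hxe
    simp only [mem_union, mem_image, mem_univ, true_and, not_or, not_exists] at hxP hyP
    obtain ⟨t, rfl⟩ := exists_triple_of_mem_of_mem (hE e he) hxe hye hxy
    refine hq3 ⟨Fin.cons x p, Fin.cons y r, Fin.cons t z, ?_, ?_, ?_, ?_⟩
    · intro i
      refine Fin.cases ⟨hx, hy, he⟩ (fun i => ?_) i
      simpa using hprz i
    · exact Fin.cons_injective_iff.2 ⟨by simpa using hxP.1, hp⟩
    · exact Fin.cons_injective_iff.2 ⟨by simpa using hyP.2, hr⟩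
    · intro i j
      refine Fin.cases ?_ (fun i => ?_) i <;> refine Fin.cases ?_ (fun j => ?_) j
      · simpa using hxy
      · simpa using Ne.symm (hxP.2 j)
      · simpa using hyP.1 i
      · simpa using hpr i j

/-- Removing the colour `p i` from all pairs through `z i` costs at most |Sᶜ| edges for each i.
Afterwards no pair has both colours `p i` and `r i`, so the weights are at most |S|-q. Mantel with m
= |S|-q and K = |S| requires 2|S| ≤ 3(|S|-q), that is 3q ≤ |S|. -/
theorem card_outer_le_of_hasPairs (hE : ∀ e ∈ E, e.card = 3) (hF : NoF5 E) (hS : 3 ≤ S.card)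
    {q : ℕ} (hq : 3 * q ≤ S.card) (hpairs : HasPairs E S q) :
    (E.filter fun e => (e ∩ S).card = 1).card ≤
      (S.card - q) * (Sᶜ.card ^ 2 / 4) + q * Sᶜ.card := by
  obtain ⟨p, r, z, hprz, hp, hr, hpr⟩ := hpairs
  let C : V → V → Finset V := fun u v =>
    (colours E S u v).filter fun x => ∀ i, x = p i → z i ≠ u ∧ z i ≠ v
  have hCc : ∀ u v, C u v ⊆ colours E S u v := fun u v => filter_subset _ _
  have hCS : ∀ u v, C u v ⊆ S := fun u v => (hCc u v).trans (filter_subset _ _)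
  have hs : ∀ u v, C u v = C v u := by
    intro u v
    simp only [C, colours_comm u v, and_comm]
  have h0 : ∀ u, C u u = ∅ := fun u => subset_empty.1 ((hCc u u).trans (colours_self hE u).subset)
  have hle : ∀ u v, (C u v).card ≤ S.card - q := by
    intro u v
    have h1 : ∀ i, p i ∈ C u v → r i ∈ C u v → False := by
      intro i h1 h2
      obtain ⟨h1, h3⟩ := mem_filter.1 h1
      have h1' := (mem_filter.1 h1).2
      have h2' := (mem_filter.1 (hCc _ _ h2)).2
      rw [triple_rotate] at h1' h2'
      rcases hF u v (p i) (r i) (z i) h1' h2' (hprz i).2.2 with h | h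
      · exact (h3 i rfl).1 h
      · exact (h3 i rfl).2 h
    -- For each i choose one of `p i`, `r i` that is missing from `C u v`; the pairs are disjoint,
    -- so q colours are missing.
    let g : Fin q → V := fun i => if p i ∈ C u v then r i else p i
    have hg : ∀ i, g i ∈ S \ C u v := by
      intro i
      simp only [g, mem_sdiff]
      split_ifs with h
      · exact ⟨(hprz i).2.1, h1 i h⟩
      · exact ⟨(hprz i).1, h⟩
    have hginj : Function.Injective g := by
      intro i j hij
      simp only [g] at hij
      split_ifs at hij
      · exact hr hij
      · exact absurd hij.symm (hpr j i)
      · exact absurd hij (hpr i j)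
      · exact hp hij
    have h2 := card_le_card_of_injOn g (s := univ) (t := S \ C u v) (fun i _ => hg i)
      hginj.injOn
    have h3 := card_le_card (hCS u v)
    rw [card_univ, Fintype.card_fin, card_sdiff_of_subset (hCS u v)] at h2
    omega
  have hmantel := sum_pairs_le (w := fun u v => (C u v).card) (m := S.card - q) (K := max S.card 3)
    (by rw [max_eq_left hS]; omega) (fun u v => by rw [hs]) (fun u => by simp [h0]) Sᶜ
    (fun u _ v _ => hle u v)
    (fun u hu v hv t ht => triangle_card_le hF hCc hs (mem_compl.1 hu) (mem_compl.1 hv)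
      (mem_compl.1 ht))
  have hloss : ∀ u v, (colours E S u v).card ≤ (C u v).card +
      ((univ.filter fun i => z i = u).card + (univ.filter fun i => z i = v).card) := by
    intro u v
    have : colours E S u v ⊆ C u v ∪ ((univ.filter fun i => z i = u).image p ∪
        (univ.filter fun i => z i = v).image p) := by
      intro x hx
      by_cases h : x ∈ C u v
      · exact mem_union_left _ h
      · have h' : ¬ ∀ i, x = p i → z i ≠ u ∧ z i ≠ v := fun h' => h (mem_filter.2 ⟨hx, h'⟩)
        push Not at h'
        obtain ⟨i, rfl, hi⟩ := h'
        by_cases hzu : z i = u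
        · exact mem_union_right _ (mem_union_left _ (mem_image_of_mem _ (by simp [hzu])))
        · exact mem_union_right _ (mem_union_right _ (mem_image_of_mem _ (by simp [hi hzu])))
    refine (card_le_card this).trans ((card_union_le _ _).trans ?_)
    gcongr
    refine (card_union_le _ _).trans ?_
    gcongr <;> exact card_image_le
  have hcount : ∑ u ∈ Sᶜ, (univ.filter fun i => z i = u).card ≤ q := by
    rw [← card_biUnion]
    · exact (card_le_univ _).trans (by simp)
    · intro a _ b _ hab
      refine disjoint_left.2 fun i h1 h2 => hab ?_
      rw [← (mem_filter.1 h1).2, (mem_filter.1 h2).2]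
  have htotal : ∑ u ∈ Sᶜ, ∑ v ∈ Sᶜ, (colours E S u v).card ≤
      ∑ u ∈ Sᶜ, ∑ v ∈ Sᶜ, (C u v).card + 2 * (Sᶜ.card * q) := by
    refine (sum_le_sum fun u _ => sum_le_sum fun v _ => hloss u v).trans ?_
    simp only [sum_add_distrib, sum_const, smul_eq_mul, ← mul_sum]
    nlinarith [Nat.mul_le_mul_left Sᶜ.card hcount]
  have h2 := two_mul_card_le_sum_colours (S := S) hE
  nlinarith

/-- Here a triangle may have three colours in total, so K = 3, and m = 2 is the least cap with 2K ≤
3m. -/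
theorem card_outer_le_of_card_le_two (hE : ∀ e ∈ E, e.card = 3) (hF : NoF5 E) (hS : S.card ≤ 2) :
    (E.filter fun e => (e ∩ S).card = 1).card ≤ 2 * (Sᶜ.card ^ 2 / 4) := by
  have h2 := two_mul_card_le_sum_colours (S := S) hE
  have hmantel := sum_pairs_le (w := fun u v => (colours E S u v).card) (m := 2)
    (K := max S.card 3) (by rw [max_eq_right (by omega)])
    (fun u v => by rw [colours_comm]) (fun u => by simp [colours_self hE]) Sᶜ
    (fun u _ v _ => (card_le_card (filter_subset _ _)).trans hS)
    (fun u hu v hv t ht => triangle_card_le hF (fun _ _ => subset_rfl) colours_comm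
      (mem_compl.1 hu) (mem_compl.1 hv) (mem_compl.1 ht))
  omega

end Inner

/-! ### Numerical inequalities; L stands for n - s, and n ≥ 30(s+1) gives L ≥ 29s + 30. -/

section Numerics

theorem four_mul_sq_div_four_le (N : ℕ) : 4 * (N ^ 2 / 4) ≤ N ^ 2 := Nat.mul_div_le _ _

theorem sq_le_four_mul_sq_div_four (N : ℕ) : N ^ 2 ≤ 4 * (N ^ 2 / 4) + 3 := by
  generalize N ^ 2 = x
  omega

theorem pair_loss_lt {N k : ℕ} (h : 29 * k + 30 ≤ N) : N + 5 * k * (N + k) < N ^ 2 / 4 := by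
  have h1 := sq_le_four_mul_sq_div_four N
  obtain ⟨t, rfl⟩ := Nat.exists_eq_add_of_le h
  nlinarith [Nat.zero_le (k * t), Nat.zero_le (t * t), Nat.zero_le (k * k)]

theorem missing_heavy_lt {L k d : ℕ} (hd : 1 ≤ d) (h : 29 * (k + d) + 30 ≤ L) :
    k * ((L + d) ^ 2 / 4) + 3 * d * ((k + d) * (L + (k + d))) < (k + d) * (L ^ 2 / 4) := by
  have h1 := sq_le_four_mul_sq_div_four L
  have h2 := four_mul_sq_div_four_le (L + d)
  have h3 : k * (4 * ((L + d) ^ 2 / 4)) ≤ k * (L + d) ^ 2 := Nat.mul_le_mul_left _ h2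
  have h4 : (k + d) * L ^ 2 ≤ (k + d) * (4 * (L ^ 2 / 4) + 3) := Nat.mul_le_mul_left _ h1
  have key : k * (L + d) ^ 2 + 12 * d * ((k + d) * (L + (k + d))) + 3 * (k + d) <
      (k + d) * L ^ 2 := by
    -- Since (k+d)L² - k(L+d)² = d(L² - 2kL - kd), a factor d can be cancelled from the claim.
    have h5 : 2 * k * L + k * d + 12 * ((k + d) * (L + (k + d))) + 3 * (k + d) < L * L := by
      obtain ⟨t, rfl⟩ := Nat.exists_eq_add_of_le h
      nlinarith [Nat.zero_le (k * t), Nat.zero_le (d * t), Nat.zero_le (t * t),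
        Nat.zero_le (k * k), Nat.zero_le (k * d), Nat.zero_le (d * d)]
    have h6 := Nat.mul_lt_mul_of_pos_left h5 (show 0 < d by omega)
    have h7 : 3 * (k + d) ≤ d * (3 * (k + d)) := Nat.le_mul_of_pos_left _ (by omega)
    nlinarith
  nlinarith

/-- With one or two heavy vertices the quadratic coefficient is at most 2/4, against s/4 with s ≥ 3;
the remaining terms are linear in n for fixed s. -/
theorem few_heavy_lt {L s N d n : ℕ} (hs : 3 ≤ s) (h : 29 * s + 30 ≤ L) (hn : n = L + s)
    (hN : N + 1 ≤ n) (hd : d + 1 ≤ s) :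
    2 * (N ^ 2 / 4) + 4 * n + 3 * d * (s * n) < s * (L ^ 2 / 4) := by
  have h1 := sq_le_four_mul_sq_div_four L
  have h2 := four_mul_sq_div_four_le N
  have h4 : s * L ^ 2 ≤ s * (4 * (L ^ 2 / 4) + 3) := Nat.mul_le_mul_left _ h1
  have h5 : N ^ 2 ≤ (L + s) ^ 2 := Nat.pow_le_pow_left (by omega) 2
  obtain ⟨r, rfl⟩ := Nat.exists_eq_add_of_le hs
  have h6 : d * ((3 + r) * n) ≤ (r + 2) * ((3 + r) * n) := Nat.mul_le_mul_right _ (by omega)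
  have key : 2 * (L + (3 + r)) ^ 2 + 16 * n + 12 * ((r + 2) * ((3 + r) * n)) + 3 * (3 + r) <
      (3 + r) * L ^ 2 := by
    subst hn
    obtain ⟨t, rfl⟩ := Nat.exists_eq_add_of_le h
    ring_nf
    nlinarith [Nat.zero_le (r * t), Nat.zero_le (r * t * t), Nat.zero_le (t * t),
      Nat.zero_le (r * r), Nat.zero_le (r * r * r), Nat.zero_le (r * r * t)]
  nlinarith

theorem no_heavy_lt {L s n : ℕ} (hs : 1 ≤ s) (h : 29 * s + 30 ≤ L) (hn : n = L + s) :
    3 * s * (s * n) < s * (L ^ 2 / 4) := by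
  have h1 := sq_le_four_mul_sq_div_four L
  have : 3 * s * n < L ^ 2 / 4 := by
    subst hn
    obtain ⟨t, rfl⟩ := Nat.exists_eq_add_of_le h
    nlinarith [Nat.zero_le (s * t), Nat.zero_le (t * t), Nat.zero_le (s * s)]
  calc 3 * s * (s * n) = s * (3 * s * n) := by ring
    _ < _ := Nat.mul_lt_mul_of_pos_left this (by omega)

end Numerics

/-! ### Stability and the extremal structure for s ≥ 3. -/

section Large

variable {V : Type*} [DecidableEq V] [Fintype V] {E : Finset (Finset V)} {s : ℕ}

/-- In a triple system with many edges there are `s` heavy vertices, and every edge contains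
exactly one of them. -/
theorem heavy_of_large (hE : ∀ e ∈ E, e.card = 3) (hF : NoF5 E)
    (hν : ∀ M ⊆ E, (M : Set (Finset V)).PairwiseDisjoint id → M.card ≤ s) (hs : 3 ≤ s)
    (hn : 30 * (s + 1) ≤ Fintype.card V)
    (hlarge : s * ((Fintype.card V - s) ^ 2 / 4) ≤ E.card) :
    (heavy E s).card = s ∧ ∀ e ∈ E, (e ∩ heavy E s).card = 1 := by
  have hk := card_heavy_le hE hF hν
  have hR := card_disjoint_heavy_le hE hF hν
  have hsplit := card_eq_add_add E (heavy E s)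
  have hcompl := card_compl (heavy E s)
  have hsq := card_inner_le_sq (S := heavy E s) hE
  have houter := card_outer_le_of_card_le_two (S := heavy E s) hE hF
  have houter' := card_outer_le_of_hasPairs (S := heavy E s) hE hF
  set S := heavy E s
  obtain ⟨L, hL⟩ : ∃ L, Fintype.card V = L + s := ⟨Fintype.card V - s, by omega⟩
  have hLs : 29 * s + 30 ≤ L := by omega
  rw [show Fintype.card V - s = L by omega] at hlarge
  obtain ⟨d, hd⟩ : ∃ d, s = S.card + d := ⟨s - S.card, by omega⟩
  rw [show s - S.card = d by omega] at hR
  have hRn : (E.filter fun e => Disjoint e S).card ≤ 3 * d * (s * Fintype.card V) :=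
    hR.trans (by gcongr; omega)
  by_cases h3 : 3 ≤ S.card
  · obtain ⟨q, hq, hqp, hinner⟩ := exists_hasPairs hE h3
    have ho := houter' h3 hq hqp
    rw [show Sᶜ.card = L + d by omega] at ho
    obtain ⟨j, hj⟩ : ∃ j, S.card = q + j := ⟨S.card - q, by omega⟩
    rw [show S.card - q = j by omega] at ho
    have hloss := pair_loss_lt (N := L + d) (k := S.card) (by omega)
    rw [show L + d + S.card = Fintype.card V by omega] at hloss
    have hloss' : q * (L + d + 5 * S.card * Fintype.card V) + q ≤ q * ((L + d) ^ 2 / 4) := by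
      calc _ = q * (L + d + 5 * S.card * Fintype.card V + 1) := by ring
        _ ≤ _ := Nat.mul_le_mul_left _ hloss
    -- The slack q is kept because it later forces q = 0 when the total is extremal.
    have hsum : (E.filter fun e => (e ∩ S).card = 1).card +
        (E.filter fun e => 2 ≤ (e ∩ S).card).card + q ≤ S.card * ((L + d) ^ 2 / 4) := by
      rw [hj, add_mul]
      rw [hj] at hloss' hinner
      nlinarith
    -- Each missing heavy vertex loses about L²/4 edges, while the edges avoiding S make up only a
    -- linear amount.
    have hd0 : d = 0 := by
      by_contra hd0
      have hm := missing_heavy_lt (L := L) (k := S.card) (d := d) (by omega) (by omega)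
      rw [← hd, ← hL] at hm
      omega
    subst hd0
    simp only [mul_zero, zero_mul, add_zero, Nat.le_zero] at hRn hd hsum
    rw [← hd] at hsum
    have hq0 : q = 0 := by omega
    subst hq0
    simp only [mul_zero, zero_mul, Nat.le_zero] at hinner
    refine ⟨hd.symm, fun e he => ?_⟩
    have h1 := filter_eq_empty_iff.1 (card_eq_zero.1 hRn) he
    have h2 := filter_eq_empty_iff.1 (card_eq_zero.1 hinner) he
    rw [disjoint_iff_inter_eq_empty, ← card_eq_zero] at h1
    omega
  · exfalso
    rcases Nat.eq_zero_or_pos S.card with h0 | h0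
    · have ho := no_heavy_lt (L := L) (s := s) (by omega) hLs hL
      have hds : d = s := by omega
      rw [hds] at hRn
      rw [card_eq_zero] at h0
      simp only [h0, inter_empty, card_empty] at hsplit hRn
      simp at hsplit
      simp at hRn
      omega
    · have ho := houter (by omega)
      have hf := few_heavy_lt (L := L) (s := s) (N := Sᶜ.card) (d := d) hs hLs hL
        (by omega) (by omega)
      have h4 : S.card * S.card * Fintype.card V ≤ 4 * Fintype.card V := by
        have : S.card * S.card ≤ 2 * 2 := Nat.mul_le_mul (by omega) (by omega)
        exact Nat.mul_le_mul_right _ this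
      omega

/-- The edges of the complete tripartite triple system with the given colour classes. -/
def rainbow (c : V → Fin 3) : Finset (Finset V) :=
  (univ.powersetCard 3).filter fun e => ∀ x ∈ e, ∀ y ∈ e, c x = c y → x = y

theorem exists_triple_of_injective {V : Type*} [DecidableEq V] {c : V → Fin 3} {e : Finset V}
    (he : e.card = 3) (hinj : ∀ x ∈ e, ∀ y ∈ e, c x = c y → x = y) {i j : Fin 3} (hi : i ≠ 0)
    (hj : j ≠ 0) (hij : i ≠ j) : ∃ x a b, c x = 0 ∧ c a = i ∧ c b = j ∧ e = {x, a, b} := by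
  have himg : e.image c = univ := eq_univ_of_card _ (by
    rw [card_image_of_injOn (fun x hx y hy h => hinj x hx y hy h), he]; rfl)
  have hex : ∀ t : Fin 3, ∃ x ∈ e, c x = t := fun t => mem_image.1 (himg ▸ mem_univ t)
  obtain ⟨x, hxe, hx⟩ := hex 0
  obtain ⟨a, hae, ha⟩ := hex i
  obtain ⟨b, hbe, hb⟩ := hex j
  have hxa : x ≠ a := by rintro rfl; exact hi (ha.symm.trans hx)
  have hxb : x ≠ b := by rintro rfl; exact hj (hb.symm.trans hx)
  have hab : a ≠ b := by rintro rfl; exact hij (ha.symm.trans hb)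
  exact ⟨x, a, b, hx, ha, hb, (eq_of_subset_of_card_le
    (by simp [insert_subset_iff, hxe, hae, hbe])
    (by rw [he, card_eq_three.2 ⟨x, a, b, hxa, hxb, hab, rfl⟩])).symm⟩

theorem eq_rainbow (hE : ∀ e ∈ E, e.card = 3) {c : V → Fin 3} {i j : Fin 3} (hi : i ≠ 0)
    (hj : j ≠ 0) (hij : i ≠ j)
    (h1 : ∀ e ∈ E, ∃ x a b, c x = 0 ∧ c a = i ∧ c b = j ∧ e = {x, a, b})
    (h2 : ∀ x a b, c x = 0 → c a = i → c b = j → ({x, a, b} : Finset V) ∈ E) : E = rainbow c := by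
  ext e
  simp only [rainbow, mem_filter, mem_powersetCard_univ]
  constructor
  · intro he
    refine ⟨hE e he, ?_⟩
    obtain ⟨x, a, b, hx, ha, hb, rfl⟩ := h1 e he
    have hxa : c x ≠ c a := by rw [hx, ha]; exact hi.symm
    have hxb : c x ≠ c b := by rw [hx, hb]; exact hj.symm
    have hab : c a ≠ c b := by rw [ha, hb]; exact hij
    simp only [mem_insert, mem_singleton]
    rintro y hy z hz hyz
    rcases hy with rfl | rfl | rfl <;> rcases hz with rfl | rfl | rfl <;>
      first | rfl | exact absurd hyz ‹_› | exact absurd hyz.symm ‹_›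
  · rintro ⟨he, hinj⟩
    obtain ⟨x, a, b, hx, ha, hb, rfl⟩ := exists_triple_of_injective he hinj hi hj hij
    exact h2 x a b hx ha hb

/-- If a and b differ by at least 2, then 4ab ≤ (a+b)² - 4, which the floor, losing at most 3,
cannot absorb. -/
theorem eq_of_mul_eq_sq_div_four {a b N : ℕ} (hab : a + b = N) (h : N ^ 2 / 4 ≤ a * b) :
    (a = N / 2 ∧ b = N - N / 2) ∨ (b = N / 2 ∧ a = N - N / 2) := by
  have h1 := sq_le_four_mul_sq_div_four N
  have h2 : N ^ 2 ≤ 4 * (a * b) + 3 := by omega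
  have h3 : a ≤ b + 1 := by
    by_contra! hlt
    obtain ⟨t, rfl⟩ := Nat.exists_eq_add_of_le hlt
    subst hab
    nlinarith
  have h4 : b ≤ a + 1 := by
    by_contra! hlt
    obtain ⟨t, rfl⟩ := Nat.exists_eq_add_of_le hlt
    subst hab
    nlinarith
  omega

theorem rainbow_of_large (hE : ∀ e ∈ E, e.card = 3) (hF : NoF5 E)
    (hν : ∀ M ⊆ E, (M : Set (Finset V)).PairwiseDisjoint id → M.card ≤ s) (hs : 3 ≤ s)
    (hn : 30 * (s + 1) ≤ Fintype.card V)
    (hlarge : s * ((Fintype.card V - s) ^ 2 / 4) ≤ E.card) :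
    ∃ c : V → Fin 3, E = rainbow c ∧ (univ.filter fun x => c x = 0).card = s ∧
      (univ.filter fun x => c x = 1).card = (Fintype.card V - s) / 2 ∧
      (univ.filter fun x => c x = 2).card =
        Fintype.card V - s - (Fintype.card V - s) / 2 := by
  obtain ⟨hS, hE1⟩ := heavy_of_large hE hF hν hs hn hlarge
  set S := heavy E s
  have hcompl : Sᶜ.card = Fintype.card V - s := by rw [card_compl, hS]
  have hsumle := two_mul_card_le_sum_colours (S := S) hE
  rw [filter_true_of_mem hE1] at hsumle
  rw [← hcompl] at hlarge ⊢
  set w : V → V → ℕ := fun u v => (colours E S u v).card with hw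
  replace hsumle : 2 * E.card ≤ ∑ u ∈ Sᶜ, ∑ v ∈ Sᶜ, w u v := hsumle
  have hws : ∀ u v, w u v = w v u := fun u v => by simp only [hw, colours_comm u v]
  have hw0 : ∀ u, w u u = 0 := fun u => by simp [hw, colours_self hE]
  -- Every edge meets S exactly once, so the colour weights attain the Mantel bound and the equality
  -- case applies.
  have hsat := fun {u v : V} => saturated_of_sum_pairs_eq (w := w) (m := s) (W := Sᶜ) (u := u)
    (v := v) hws hw0
    (fun u _ v _ => (card_le_card (filter_subset _ _)).trans hS.le)
    (fun u hu v hv t ht h1 h2 h3 => by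
      have := triangle_card_le hF (fun _ _ => subset_rfl) colours_comm
        (mem_compl.1 hu) (mem_compl.1 hv) (mem_compl.1 ht) h1 h2 h3
      rwa [hS, max_eq_left hs] at this)
    (by omega)
  have hQ : 0 < Sᶜ.card ^ 2 / 4 := Nat.div_pos (by nlinarith [show 4 ≤ Sᶜ.card by omega])
    (by norm_num)
  have hEpos : 0 < E.card := lt_of_lt_of_le (Nat.mul_pos (by omega) hQ) hlarge
  have hedge : ∀ e ∈ E, ∃ x u v, e = {x, u, v} ∧ x ∈ S ∧ u ∈ Sᶜ ∧ v ∈ Sᶜ ∧ 0 < w u v := by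
    intro e he
    obtain ⟨x, hx⟩ := card_eq_one.1 (hE1 e he)
    have hxe := mem_inter.1 (hx ▸ mem_singleton_self x : x ∈ e ∩ S)
    obtain ⟨u, v, rfl⟩ := exists_triple_of_mem (hE e he) hxe.1
    obtain ⟨hxu, hxv, huv⟩ := ne_of_triple_card (hE _ he)
    have hnot : ∀ t ∈ ({x, u, v} : Finset V), x ≠ t → t ∈ Sᶜ := by
      intro t ht hxt
      refine mem_compl.2 fun htS => ?_
      have : t ∈ ({x} : Finset V) := hx ▸ mem_inter.2 ⟨ht, htS⟩
      exact hxt (mem_singleton.1 this).symm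
    exact ⟨x, u, v, rfl, hxe.2, hnot u (by simp) hxu, hnot v (by simp) hxv,
      card_pos.2 ⟨x, mem_filter.2 ⟨hxe.2, he⟩⟩⟩
  obtain ⟨e₀, he₀⟩ := card_pos.1 hEpos
  obtain ⟨-, u, v, -, -, hu, hv, huv⟩ := hedge e₀ he₀
  -- The neighbourhood of v and its complement in Sᶜ are the two classes: by saturation every pair
  -- across has all s colours, and every pair inside a class has none.
  set A := Sᶜ.filter fun z => 0 < w v z with hA
  set B := Sᶜ.filter fun z => ¬ 0 < w v z with hB
  have hABcard : A.card + B.card = Sᶜ.card := card_filter_add_card_filter_not _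
  have hvB : v ∈ B := mem_filter.2 ⟨hv, by simp [hw0]⟩
  have hnoA : ∀ a ∈ A, ∀ b ∈ A, w a b = 0 := by
    intro a ha b hb
    obtain ⟨ha, ha'⟩ := mem_filter.1 ha
    obtain ⟨hb, hb'⟩ := mem_filter.1 hb
    rcases (hsat hv ha ha').2 b hb with h | h <;> omega
  have hAB : ∀ a ∈ A, ∀ b ∈ B, w a b = s := by
    intro a ha b hb
    obtain ⟨ha, ha'⟩ := mem_filter.1 ha
    obtain ⟨hb, hb'⟩ := mem_filter.1 hb
    rcases (hsat hv ha ha').2 b hb with h | h <;> omega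
  have huA : u ∈ A := mem_filter.2 ⟨hu, by rwa [hws]⟩
  have hnoB : ∀ a ∈ B, ∀ b ∈ B, w a b = 0 := by
    intro a ha b hb
    have h1 := hAB u huA a ha
    have h2 := hAB u huA b hb
    rcases (hsat hu (mem_filter.1 ha).1 (by omega)).2 b (mem_filter.1 hb).1 with h | h <;> omega
  have hmem : ∀ x ∈ S, ∀ a ∈ A, ∀ b ∈ B, ({x, a, b} : Finset V) ∈ E := by
    intro x hx a ha b hb
    have : colours E S a b = S := eq_of_subset_of_card_le (filter_subset _ _) (by
      rw [hS]; exact (hAB a ha b hb).ge)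
    exact (mem_filter.1 (this.symm ▸ hx : x ∈ colours E S a b)).2
  have hedge' : ∀ e ∈ E, ∃ x ∈ S, ∃ a ∈ A, ∃ b ∈ B, e = {x, a, b} := by
    intro e he
    obtain ⟨x, a, b, rfl, hx, ha, hb, hab⟩ := hedge e he
    by_cases ha' : a ∈ A <;> by_cases hb' : b ∈ A
    · have := hnoA a ha' b hb'
      omega
    · exact ⟨x, hx, a, ha', b, mem_filter.2 ⟨hb, fun h => hb' (mem_filter.2 ⟨hb, h⟩)⟩, rfl⟩
    · exact ⟨x, hx, b, hb', a, mem_filter.2 ⟨ha, fun h => ha' (mem_filter.2 ⟨ha, h⟩)⟩,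
        triple_swap _ _ _⟩
    · have := hnoB a (mem_filter.2 ⟨ha, fun h => ha' (mem_filter.2 ⟨ha, h⟩)⟩) b
        (mem_filter.2 ⟨hb, fun h => hb' (mem_filter.2 ⟨hb, h⟩)⟩)
      omega
  have hcardE : E.card ≤ s * (A.card * B.card) := by
    have : E ⊆ (S ×ˢ A ×ˢ B).image fun p => {p.1, p.2.1, p.2.2} := by
      intro e he
      obtain ⟨x, hx, a, ha, b, hb, rfl⟩ := hedge' e he
      exact mem_image.2 ⟨(x, a, b), by simp [hx, ha, hb], rfl⟩
    refine (card_le_card this).trans (card_image_le.trans ?_)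
    rw [card_product, card_product, hS]
  have hprod : Sᶜ.card ^ 2 / 4 ≤ A.card * B.card :=
    Nat.le_of_mul_le_mul_left (hlarge.trans hcardE) (by omega)
  have hBS : ∀ x, x ∉ S → x ∉ A → x ∈ B := fun x h1 h2 =>
    mem_filter.2 ⟨mem_compl.2 h1, fun h => h2 (mem_filter.2 ⟨mem_compl.2 h1, h⟩)⟩
  have hAS : ∀ x ∈ A, x ∉ S := fun x h => mem_compl.1 (mem_filter.1 h).1
  have hBS' : ∀ x ∈ B, x ∉ S := fun x h => mem_compl.1 (mem_filter.1 h).1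
  have hBA : ∀ x ∈ B, x ∉ A := fun x h h' => (mem_filter.1 h).2 (mem_filter.1 h').2
  -- the two classes outside `S` may be labelled in either order
  have main : ∀ i j : Fin 3, i ≠ 0 → j ≠ 0 → i ≠ j →
      ∃ c : V → Fin 3, E = rainbow c ∧ (univ.filter fun x => c x = 0).card = s ∧
        (univ.filter fun x => c x = i).card = A.card ∧
        (univ.filter fun x => c x = j).card = B.card := by
    intro i j hi hj hij
    let c : V → Fin 3 := fun x => if x ∈ S then 0 else if x ∈ A then i else j
    have cS : ∀ x ∈ S, c x = 0 := fun x h => if_pos h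
    have cA : ∀ x ∈ A, c x = i := fun x h => by simp only [c]; rw [if_neg (hAS x h), if_pos h]
    have cB : ∀ x ∈ B, c x = j := fun x h => by
      simp only [c]; rw [if_neg (hBS' x h), if_neg (hBA x h)]
    have c0 : ∀ x, c x = 0 ↔ x ∈ S := fun x => by
      by_cases h1 : x ∈ S <;> by_cases h2 : x ∈ A <;> simp [c, h1, h2, hi, hj]
    have ci : ∀ x, c x = i ↔ x ∈ A := fun x => by
      by_cases h1 : x ∈ S
      · have h2 : x ∉ A := fun h => hAS x h h1
        simp [c, h1, h2, hi.symm]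
      · by_cases h2 : x ∈ A <;> simp [c, h1, h2, hij.symm]
    have cj : ∀ x, c x = j ↔ x ∈ B := fun x => by
      refine ⟨fun h => hBS x (fun h1 => hj ?_) (fun h1 => hij ?_), cB x⟩
      · rw [← h, cS x h1]
      · rw [← h, cA x h1]
    refine ⟨c, ?_, by simp [c0, hS], by simp [ci], by simp [cj]⟩
    refine eq_rainbow hE hi hj hij (fun e he => ?_) fun x a b hx ha hb =>
      hmem x ((c0 x).1 hx) a ((ci a).1 ha) b ((cj b).1 hb)
    obtain ⟨x, hx, a, ha, b, hb, rfl⟩ := hedge' e he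
    exact ⟨x, a, b, cS x hx, cA a ha, cB b hb, rfl⟩
  rcases eq_of_mul_eq_sq_div_four hABcard hprod with ⟨h1, h2⟩ | ⟨h1, h2⟩
  · obtain ⟨c, hc, hc0, hc1, hc2⟩ := main 1 2 (by decide) (by decide) (by decide)
    exact ⟨c, hc, hc0, hc1.trans h1, hc2.trans h2⟩
  · obtain ⟨c, hc, hc0, hc1, hc2⟩ := main 2 1 (by decide) (by decide) (by decide)
    exact ⟨c, hc, hc0, hc2.trans h1, hc1.trans h2⟩

end Large

/-! ### The cases s = 1 and s = 2. -/

section Star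

variable {V : Type*} [DecidableEq V]

theorem choose_two_mul_two (N : ℕ) : 2 * N.choose 2 = N * (N - 1) := by
  rw [Nat.choose_two_right, Nat.mul_div_cancel' (Nat.even_mul_pred_self N).two_dvd]

/-- An intersecting triple system without a common vertex is small. -/
theorem card_le_of_intersecting {R : Finset (Finset V)} (hR : ∀ e ∈ R, e.card = 3) (hF : NoF5 R)
    {U : Finset V} (hU : ∀ e ∈ R, e ⊆ U) (hint : ∀ e ∈ R, ∀ f ∈ R, ¬ Disjoint e f)
    (hstar : ∀ y, ∃ e ∈ R, y ∉ e) : R.card ≤ max 36 (2 * (U.card - 1) - 5) := by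
  -- Four common edges would already force the covering below; the fifth gives the -5 in the bound,
  -- which the final count for s = 2 needs exactly.
  by_cases h : ∃ y a, y ≠ a ∧ 5 ≤ (R.filter fun e => y ∈ e ∧ a ∈ e).card
  · obtain ⟨y, a, hya, h5⟩ := h
    have hcover : ∀ e ∈ R, y ∈ e ∨ a ∈ e := by
      intro e he
      by_contra! hcon
      -- An edge avoiding y and a must meet each edge yaz in z, so its three vertices account for
      -- all of these edges.
      have hsub : (R.filter fun f => y ∈ f ∧ a ∈ f) ⊆ e.image fun z => {y, a, z} := by
        intro f hf
        obtain ⟨hf, hyf, haf⟩ := mem_filter.1 hf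
        obtain ⟨z, rfl⟩ := exists_triple_of_mem_of_mem (hR f hf) hyf haf hya
        obtain ⟨t, hte, ht⟩ := not_disjoint_iff.1 (hint e he _ hf)
        simp only [mem_insert, mem_singleton] at ht
        rcases ht with rfl | rfl | rfl
        · exact absurd hte hcon.1
        · exact absurd hte hcon.2
        · exact mem_image_of_mem _ hte
      have := (card_le_card hsub).trans card_image_le
      rw [hR e he] at this
      omega
    have hdeg : ∀ v ∈ U, (R.filter fun e => v ∈ e).card ≤ U.card - 1 := by
      intro v hv
      obtain ⟨m, hm, hvm⟩ := hstar v
      refine le_trans (card_le_card fun e he => ?_) (card_star_meeting_le hR hF hU hv hm hvm)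
      obtain ⟨he, hve⟩ := mem_filter.1 he
      exact mem_filter.2 ⟨he, hve, hint e he m hm⟩
    obtain ⟨f, hf⟩ := card_pos.1 (lt_of_lt_of_le (by norm_num) h5)
    obtain ⟨hf, hyf, haf⟩ := mem_filter.1 hf
    have hy := hdeg y (hU f hf hyf)
    have ha := hdeg a (hU f hf haf)
    have hunion : (R.filter fun e => y ∈ e) ∪ (R.filter fun e => a ∈ e) = R := by
      rw [← filter_or]
      exact filter_true_of_mem hcover
    have hcard := card_union_add_card_inter (R.filter fun e => y ∈ e) (R.filter fun e => a ∈ e)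
    rw [hunion, ← filter_and] at hcard
    omega
  · push Not at h
    -- An edge m avoiding v meets all edges at v, and each of its three vertices has codegree at
    -- most 4 with v. A maximal matching is a single edge, whence 3 · 12 = 36.
    have hdeg : ∀ v, (R.filter fun e => v ∈ e).card ≤ 12 := by
      intro v
      obtain ⟨m, hm, hvm⟩ := hstar v
      have hsub : (R.filter fun e => v ∈ e) ⊆ m.biUnion fun p => R.filter fun e => v ∈ e ∧ p ∈ e := by
        intro e he
        obtain ⟨he, hve⟩ := mem_filter.1 he
        obtain ⟨p, hp, hpm⟩ := not_disjoint_iff.1 (hint e he m hm)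
        exact mem_biUnion.2 ⟨p, hpm, mem_filter.2 ⟨he, hve, hp⟩⟩
      refine (card_le_card hsub).trans ((card_biUnion_le_card_mul _ _ 4 fun p hp => ?_).trans ?_)
      · have := h v p (fun hvp => hvm (hvp ▸ hp))
        omega
      · rw [hR m hm]
    have hR1 := card_le_of_degree_le hR (t := 1) (d := 12) (fun M hM hd => by
      refine card_le_one.2 fun e he f hf => ?_
      by_contra hef
      exact hint e (hM he) f (hM hf) (hd he hf hef)) (fun v _ _ _ => hdeg v)
    omega

variable [Fintype V] {E : Finset (Finset V)}

/-- An edge through x disjoint from m is given by a pair outside m and x; the edges meeting m number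
at most n-1. -/
theorem card_star_le_of_notMem (hE : ∀ e ∈ E, e.card = 3) (hF : NoF5 E) {x : V} {m : Finset V}
    (hm : m ∈ E) (hx : x ∉ m) : (E.filter fun e => x ∈ e).card ≤
      (Fintype.card V - 4).choose 2 + (Fintype.card V - 1) := by
  have h1 := card_star_meeting_le hE hF (U := univ) (fun _ _ => subset_univ _) (mem_univ x) hm hx
  have h2 : (E.filter fun e => x ∈ e ∧ Disjoint e m).card ≤ (Fintype.card V - 4).choose 2 := by
    have hc : ((insert x m)ᶜ : Finset V).card = Fintype.card V - 4 := by
      rw [card_compl, card_insert_of_notMem hx, hE m hm]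
    rw [← hc, ← card_powersetCard]
    refine card_le_card_of_injOn (fun e => e.erase x) (fun e he => ?_) ?_
    · obtain ⟨he, hxe, hd⟩ := mem_filter.1 he
      refine mem_coe.2 (mem_powersetCard.2 ⟨fun t ht => ?_, ?_⟩)
      · rw [mem_compl, mem_insert, not_or]
        exact ⟨ne_of_mem_erase ht, disjoint_left.1 hd (mem_of_mem_erase ht)⟩
      · rw [card_erase_of_mem hxe, hE e he]
    · intro e he f hf hef
      have h1 := (mem_filter.1 he).2.1
      have h2 := (mem_filter.1 hf).2.1
      rw [← insert_erase h1, ← insert_erase h2]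
      exact congrArg (insert x) hef
  rw [card_univ] at h1
  have h3 : (E.filter fun e => x ∈ e) ⊆ (E.filter fun e => x ∈ e ∧ ¬ Disjoint e m) ∪
      E.filter fun e => x ∈ e ∧ Disjoint e m := by
    rw [← filter_or]
    exact monotone_filter_right _ fun e _ h => by tauto
  have h4 := (card_le_card h3).trans (card_union_le _ _)
  omega

/-- If every pair outside `S` has exactly one of the two colours in `S`, all of them have the
same colour. -/
theorem exists_common_colour (hF : NoF5 E) {x y : V} (hxy : x ≠ y)
    (hcover : ∀ e ∈ E, x ∈ e ∨ y ∈ e) (hE : ∀ e ∈ E, e.card = 3)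
    (hcard : 2 ≤ (({x, y} : Finset V)ᶜ).card)
    (h1 : ∀ u ∈ ({x, y} : Finset V)ᶜ, ∀ v ∈ ({x, y} : Finset V)ᶜ, u ≠ v →
      (colours E {x, y} u v).card = 1) : (∀ e ∈ E, x ∈ e) ∨ ∀ e ∈ E, y ∈ e := by
  set S : Finset V := {x, y} with hS
  obtain ⟨u, hu, v, hv, huv⟩ := one_lt_card.1 hcard
  obtain ⟨i, hi⟩ := card_eq_one.1 (h1 u hu v hv huv)
  have hiuv : i ∈ colours E S u v := hi ▸ mem_singleton_self i
  have hcS : ∀ {j a b}, j ∈ colours E S a b → j = x ∨ j = y := fun hj => by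
    simpa [hS] using (mem_filter.1 hj).1
  -- Suppose uz has colour j ≠ i. Colour i on vz would, through v, force i on uz; so vz has the
  -- other colour j, and then through z the colour j is forced on uv, a contradiction.
  have hu' : ∀ z ∈ Sᶜ, z ≠ u → i ∈ colours E S u z := by
    intro z hz hzu
    by_cases hzv : z = v
    · rwa [hzv]
    by_contra hcon
    obtain ⟨j, hj⟩ := card_eq_one.1 (h1 u hu z hz hzu.symm)
    obtain ⟨l, hl⟩ := card_eq_one.1 (h1 v hv z hz (Ne.symm hzv))
    have hj' : j ∈ colours E S u z := hj ▸ mem_singleton_self j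
    have hl' : l ∈ colours E S v z := hl ▸ mem_singleton_self l
    have hji : j ≠ i := fun h => hcon (h ▸ hj')
    have hli : l ≠ i := by
      rintro rfl
      rw [colours_comm] at hiuv
      exact hji (mem_singleton.1 (colours_triangle hF (mem_compl.1 hv) hiuv hl' hj'))
    have hlj : l = j := by
      rcases hcS hl' with h | h <;> rcases hcS hj' with h' | h' <;>
        rcases hcS hiuv with h'' | h'' <;> simp_all
    subst hlj
    rw [colours_comm] at hj' hl'
    exact hli (mem_singleton.1 (colours_triangle hF (mem_compl.1 hz) hj' hl' hiuv)).symm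
  have hall : ∀ a ∈ Sᶜ, ∀ b ∈ Sᶜ, a ≠ b → colours E S a b ⊆ {i} := by
    have hsub : ∀ b ∈ Sᶜ, b ≠ u → colours E S u b ⊆ {i} := by
      intro b hb hbu
      obtain ⟨j, hj⟩ := card_eq_one.1 (h1 u hu b hb hbu.symm)
      have := hu' b hb hbu
      rw [hj, mem_singleton] at this
      rw [hj, this]
    intro a ha b hb hab
    by_cases hau : a = u
    · subst hau
      exact hsub b hb hab.symm
    by_cases hbu : b = u
    · subst hbu
      rw [colours_comm]
      exact hsub a ha hab
    exact colours_triangle hF (mem_compl.1 hu) (hu' a ha hau) (hu' b hb hbu)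
  have main : ∀ j k : V, (∀ e ∈ E, j ∈ e ∨ k ∈ e) → S = {j, k} → i = j → j ≠ k →
      ∀ e ∈ E, j ∈ e := by
    intro j k hc hSjk hij hjk e he
    by_contra hje
    have hke := (hc e he).resolve_left hje
    obtain ⟨a, b, rfl⟩ := exists_triple_of_mem (hE e he) hke
    obtain ⟨hka, hkb, hab⟩ := ne_of_triple_card (hE _ he)
    simp only [mem_insert, mem_singleton, not_or] at hje
    have ha : a ∈ Sᶜ := by simp [hSjk, Ne.symm hje.2.1, hka.symm]
    have hb : b ∈ Sᶜ := by simp [hSjk, Ne.symm hje.2.2, hkb.symm]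
    have hk : k ∈ colours E S a b := mem_filter.2 ⟨by simp [hSjk], he⟩
    have := mem_singleton.1 (hall a ha b hb hab hk)
    exact hjk (hij.symm.trans this.symm)
  rcases hcS hiuv with h | h
  · exact Or.inl (main x y hcover hS h hxy)
  · exact Or.inr (main y x (fun e he => (hcover e he).symm) (by rw [hS, pair_comm]) h hxy.symm)

/-- Put N = n-2. If the codegree of x and y is at most 2, there are at most 2⌊N²/4⌋ + 2 edges, fewer
than C(N+1, 2). If it is at least 3, no pair uv has both colours, since that would confine the third
vertex of an edge xyz to u or v. Then C(N, 2) + N = C(N+1, 2) is an upper bound, and equality gives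
every pair exactly one colour. -/
theorem star_of_cover (hE : ∀ e ∈ E, e.card = 3) (hF : NoF5 E) {x y : V} (hxy : x ≠ y)
    (hcover : ∀ e ∈ E, x ∈ e ∨ y ∈ e) (hn : 10 ≤ Fintype.card V)
    (hlarge : (Fintype.card V - 1).choose 2 ≤ E.card) :
    (∀ e ∈ E, x ∈ e) ∨ ∀ e ∈ E, y ∈ e := by
  have hW : (({x, y} : Finset V)ᶜ).card = Fintype.card V - 2 := by
    rw [card_compl, card_pair hxy]
  have hsplit := card_eq_add_add E {x, y}
  have hR : (E.filter fun e => Disjoint e {x, y}).card = 0 := by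
    rw [card_eq_zero]
    refine filter_eq_empty_iff.2 fun e he hd => ?_
    rcases hcover e he with h | h
    · exact disjoint_left.1 hd h (by simp)
    · exact disjoint_left.1 hd h (by simp)
  have hinner : (E.filter fun e => 2 ≤ (e ∩ {x, y}).card) ⊆ E.filter fun e => x ∈ e ∧ y ∈ e := by
    refine monotone_filter_right _ fun e _ h => ?_
    have h2 : e ∩ {x, y} = {x, y} := eq_of_subset_of_card_le inter_subset_right (by
      rw [card_pair hxy]; exact h)
    exact ⟨inter_subset_left (h2.symm ▸ (by simp) : x ∈ e ∩ {x, y}),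
      inter_subset_left (h2.symm ▸ (by simp) : y ∈ e ∩ {x, y})⟩
  have hcodeg := card_codegree_le hE (U := univ) (fun _ _ => subset_univ _) hxy
  have hinner' := card_le_card hinner
  rw [← compl_eq_univ_sdiff, hW] at hcodeg
  obtain ⟨N, hN⟩ : ∃ N, Fintype.card V = N + 2 := ⟨Fintype.card V - 2, by omega⟩
  have hch := choose_two_mul_two (Fintype.card V - 1)
  rw [hN] at hch hlarge hcodeg hW
  simp only [Nat.add_sub_cancel, show N + 2 - 1 = N + 1 by omega] at hch hlarge hcodeg hW
  by_cases hsmall : (E.filter fun e => x ∈ e ∧ y ∈ e).card ≤ 2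
  · exfalso
    have ho := card_outer_le_of_card_le_two (S := {x, y}) hE hF card_le_two
    rw [hW] at ho
    have h4 := four_mul_sq_div_four_le N
    nlinarith
  · have hle : ∀ u v, (colours E {x, y} u v).card ≤ 1 := by
      intro u v
      by_contra! hcon
      have heq : colours E {x, y} u v = {x, y} := eq_of_subset_of_card_le (filter_subset _ _) (by
        rw [card_pair hxy]; exact hcon)
      have hx : x ∈ colours E {x, y} u v := heq.symm ▸ by simp
      have hy : y ∈ colours E {x, y} u v := heq.symm ▸ by simp
      have hx' := (mem_filter.1 hx).2
      have hy' := (mem_filter.1 hy).2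
      rw [triple_rotate] at hx' hy'
      refine hsmall ((card_le_card (t := {{x, y, u}, {x, y, v}}) fun e he => ?_).trans card_le_two)
      obtain ⟨he, hxe, hye⟩ := mem_filter.1 he
      obtain ⟨z, rfl⟩ := exists_triple_of_mem_of_mem (hE e he) hxe hye hxy
      rcases hF u v x y z hx' hy' he with rfl | rfl <;> simp
    refine exists_common_colour hF hxy hcover hE (by omega) fun u hu v hv huv => ?_
    have hsum := two_mul_card_le_sum_colours (S := {x, y}) hE
    have hle' : ∀ a b, (colours E {x, y} a b).card ≤ if a = b then 0 else 1 := by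
      intro a b
      split_ifs with h
      · rw [h, colours_self hE, card_empty]
      · exact hle a b
    have htot := sum_pairs_le_mul_pred (w := fun a b : V => if a = b then 0 else 1) (c := 1)
      (fun a => by simp) (W := ({x, y} : Finset V)ᶜ) (fun a _ b _ => by split_ifs <;> omega)
    rw [hW, mul_one] at htot
    have hNN : (N + 1) * N = N * (N - 1) + 2 * N := by
      obtain ⟨t, rfl⟩ : ∃ t, N = t + 1 := ⟨N - 1, by omega⟩
      simp only [Nat.add_sub_cancel]
      ring
    have hge : ∑ a ∈ ({x, y} : Finset V)ᶜ, ∑ b ∈ ({x, y} : Finset V)ᶜ,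
        (if a = b then 0 else 1) ≤ ∑ a ∈ ({x, y} : Finset V)ᶜ, ∑ b ∈ ({x, y} : Finset V)ᶜ,
          (colours E {x, y} a b).card := by
      omega
    have heq := le_antisymm (sum_le_sum fun a _ => sum_le_sum fun b _ => hle' a b) hge
    have h1 := (sum_eq_sum_iff_of_le fun a _ => sum_le_sum fun b _ => hle' a b).1 heq u hu
    have h2 := (sum_eq_sum_iff_of_le fun b _ => hle' u b).1 h1 v hv
    rw [h2, if_neg huv]

theorem star_of_large (hE : ∀ e ∈ E, e.card = 3) (hF : NoF5 E) {s : ℕ} (hs : s = 1 ∨ s = 2)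
    (hν : ∀ M ⊆ E, (M : Set (Finset V)).PairwiseDisjoint id → M.card ≤ s)
    (hn : 30 * (s + 1) ≤ Fintype.card V)
    (hlarge : (Fintype.card V - 1).choose 2 ≤ E.card) : ∃ x, ∀ e ∈ E, x ∈ e := by
  have hk := card_heavy_le hE hF hν
  have hR := card_disjoint_heavy_le hE hF hν
  have hM := fun M => card_add_card_heavy_le hE hF hν (M := M)
  set S := heavy E s
  have hch := choose_two_mul_two (Fintype.card V - 1)
  have hfull : S.card = s → ∀ e ∈ E, ¬ Disjoint e S := by
    intro hSs e he hd
    have := hM {e} (by simpa using he) (by simp) (by simpa using hd)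
    rw [card_singleton] at this
    omega
  obtain ⟨t, ht⟩ : ∃ t, Fintype.card V = t + 60 := ⟨Fintype.card V - 60, by omega⟩
  rcases Nat.eq_zero_or_pos S.card with h0 | hpos
  · exfalso
    rw [h0] at hR
    rw [card_eq_zero] at h0
    simp only [h0, disjoint_empty_right, filter_true] at hR
    rw [ht] at hch hlarge hR hn
    simp only [show t + 60 - 1 = t + 59 by omega, show t + 59 - 1 = t + 58 by omega] at hch hlarge hR
    rcases hs with rfl | rfl <;> nlinarith
  by_cases hSs : S.card = s
  · rcases hs with rfl | rfl
    · obtain ⟨x, hx⟩ := card_eq_one.1 hSs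
      refine ⟨x, fun e he => ?_⟩
      have := hfull hSs e he
      rwa [hx, disjoint_singleton_right, not_not] at this
    · obtain ⟨x, y, hxy, hx⟩ := card_eq_two.1 hSs
      have hcover : ∀ e ∈ E, x ∈ e ∨ y ∈ e := by
        intro e he
        have := hfull hSs e he
        rw [hx, disjoint_insert_right, disjoint_singleton_right] at this
        tauto
      rcases star_of_cover hE hF hxy hcover (by omega) hlarge with h | h
      · exact ⟨x, h⟩
      · exact ⟨y, h⟩
  -- With one heavy vertex x and s = 2, the edges avoiding x are pairwise intersecting.
  · obtain ⟨hs2, hS1⟩ : s = 2 ∧ S.card = 1 := by omega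
    subst hs2
    obtain ⟨x, hx⟩ := card_eq_one.1 hS1
    rw [hx] at hM
    have hRmem : ∀ e, e ∈ (E.filter fun e => x ∉ e) ↔ e ∈ E ∧ x ∉ e := fun e => mem_filter
    by_cases hstar : ∀ y, ∃ e ∈ E.filter (fun e => x ∉ e), y ∉ e
    · exfalso
      have hint : ∀ e ∈ E.filter (fun e => x ∉ e), ∀ f ∈ E.filter (fun e => x ∉ e),
          ¬ Disjoint e f := by
        intro e he f hf hd
        rw [hRmem] at he hf
        have hef : e ≠ f := by
          rintro rfl
          have := hE e he.1
          rw [disjoint_self.1 hd] at this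
          simp at this
        have := hM {e, f} (by simp [insert_subset_iff, he.1, hf.1])
          (by
            rw [coe_pair]
            exact Set.pairwise_pair.2 fun _ => ⟨hd, hd.symm⟩)
          (by simp [he.2, hf.2])
        rw [card_pair hef, card_singleton] at this
        omega
      have hRle := card_le_of_intersecting (fun e he => hE e ((hRmem e).1 he).1)
        (fun a b c d e h1 h2 h3 => hF a b c d e ((hRmem _).1 h1).1 ((hRmem _).1 h2).1
          ((hRmem _).1 h3).1) (U := univ.erase x)
        (fun e he t ht => mem_erase.2 ⟨fun h => ((hRmem e).1 he).2 (h ▸ ht), mem_univ t⟩)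
        hint hstar
      rw [card_erase_of_mem (mem_univ x), card_univ] at hRle
      obtain ⟨m, hm, -⟩ := hstar x
      have hdeg := card_star_le_of_notMem hE hF ((hRmem m).1 hm).1 ((hRmem m).1 hm).2
      have hsplit := card_filter_add_card_filter_not (s := E) (fun e => x ∈ e)
      have hch' := choose_two_mul_two (Fintype.card V - 4)
      rw [ht] at hch hch' hlarge hRle hdeg hn
      simp only [show t + 60 - 1 = t + 59 by omega, show t + 59 - 1 = t + 58 by omega,
        show t + 60 - 4 = t + 56 by omega, show t + 56 - 1 = t + 55 by omega] at *
      -- C(n-1, 2) - C(n-4, 2) = 3n-9, whereas the star at x has at most C(n-4, 2) + (n-1) edges and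
      -- at most max(36, 2n-9) edges avoid x. In the larger case the total falls short by exactly
      -- one.
      have : (t + 59) * (t + 58) = (t + 56) * (t + 55) + 6 * t + 342 := by ring
      omega
    · push Not at hstar
      obtain ⟨y, hy⟩ := hstar
      by_cases hxy : x = y
      · refine ⟨x, fun e he => ?_⟩
        by_contra hxe
        exact hxe (hxy ▸ hy e (mem_filter.2 ⟨he, hxe⟩))
      · have hcover : ∀ e ∈ E, x ∈ e ∨ y ∈ e := by
          intro e he
          by_cases hxe : x ∈ e
          · exact Or.inl hxe
          · exact Or.inr (hy e (mem_filter.2 ⟨he, hxe⟩))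
        rcases star_of_cover hE hF hxy hcover (by omega) hlarge with h | h
        · exact ⟨x, h⟩
        · exact ⟨y, h⟩

end Star

/-! ### Translating subgraph containment into conditions on edge sets. -/

section Containment

variable {V : Type} [DecidableEq V]

theorem contains_F5_iff (H : RGraph 3 V) : H.Contains F5 ↔ ¬ NoF5 H.edges := by
  constructor
  · rintro ⟨f, hf⟩ hno
    have h1 := hf {0, 1, 2} (by decide)
    have h2 := hf {0, 1, 3} (by decide)
    have h3 := hf {2, 3, 4} (by decide)
    simp only [map_insert, map_singleton] at h1 h2 h3
    rcases hno _ _ _ _ _ h1 h2 h3 with h | h <;> exact absurd (f.injective h) (by decide)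
  · intro hno
    simp only [NoF5, not_forall, not_or] at hno
    obtain ⟨a, b, c, d, e, h1, h2, h3, hea, heb⟩ := hno
    obtain ⟨hab, hac, hbc⟩ := ne_of_triple_card (H.uniform _ h1)
    obtain ⟨-, had, hbd⟩ := ne_of_triple_card (H.uniform _ h2)
    obtain ⟨hcd, hce, hde⟩ := ne_of_triple_card (H.uniform _ h3)
    have hinj : Function.Injective ![a, b, c, d, e] := by
      intro i j hij
      fin_cases i <;> fin_cases j <;>
        first
          | rfl
          | (exfalso; simp at hij; first | exact absurd hij ‹_› | exact absurd hij.symm ‹_›)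
    refine ⟨⟨_, hinj⟩, ?_⟩
    intro t ht
    simp only [F5, mem_insert, mem_singleton] at ht
    rcases ht with rfl | rfl | rfl <;> simpa [map_insert]

theorem contains_matching_iff (H : RGraph 3 V) (k : ℕ) :
    H.Contains (matching 3 k) ↔
      ∃ M ⊆ H.edges, (M : Set (Finset V)).PairwiseDisjoint id ∧ M.card = k := by
  constructor
  · rintro ⟨f, hf⟩
    let g : Fin k → Finset V := fun i => (({i} : Finset (Fin k)) ×ˢ (univ : Finset (Fin 3))).map f
    have hdisj : ∀ i j, i ≠ j → Disjoint (g i) (g j) := by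
      intro i j hij
      refine (disjoint_map f).2 (disjoint_left.2 fun p h1 h2 => hij ?_)
      simp only [mem_product, mem_singleton] at h1 h2
      rw [← h1.1, h2.1]
    have hinj : Function.Injective g := by
      intro i j hij
      by_contra hne
      have := hdisj i j hne
      rw [hij, disjoint_self, bot_eq_empty, map_eq_empty] at this
      exact absurd this (Nonempty.ne_empty ⟨(j, 0), by simp⟩)
    refine ⟨univ.image g, ?_, ?_, ?_⟩
    · intro e he
      obtain ⟨i, -, rfl⟩ := mem_image.1 he
      exact hf _ (mem_image_of_mem _ (mem_univ i))
    · intro e he e' he' hne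
      obtain ⟨i, -, rfl⟩ := mem_image.1 (mem_coe.1 he)
      obtain ⟨j, -, rfl⟩ := mem_image.1 (mem_coe.1 he')
      exact hdisj i j fun h => hne (h ▸ rfl)
    · rw [card_image_of_injective _ hinj, card_univ, Fintype.card_fin]
  · rintro ⟨M, hM, hd, hcard⟩
    let φ : Fin k ≃ M := (M.equivFinOfCardEq hcard).symm
    have hu : ∀ i, (φ i : Finset V).card = 3 := fun i => H.uniform _ (hM (φ i).2)
    let ψ : ∀ i, Fin 3 ≃ (φ i : Finset V) := fun i => ((φ i : Finset V).equivFinOfCardEq (hu i)).symm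
    have hinj : Function.Injective fun p : Fin k × Fin 3 => (ψ p.1 p.2 : V) := by
      rintro ⟨i, a⟩ ⟨j, b⟩ h
      simp only at h
      have hij : i = j := by
        by_contra hne
        have hφ : (φ i : Finset V) ≠ φ j := fun h => hne (φ.injective (Subtype.ext h))
        exact disjoint_left.1 (hd (φ i).2 (φ j).2 hφ) (ψ i a).2 (h ▸ (ψ j b).2)
      subst hij
      rw [(ψ i).injective (Subtype.ext h)]
    refine ⟨⟨_, hinj⟩, ?_⟩
    intro e he
    obtain ⟨i, -, rfl⟩ := mem_image.1 he
    convert hM (φ i).2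
    refine eq_of_subset_of_card_le (fun v hv => ?_) (by rw [hu, card_map]; simp)
    obtain ⟨⟨j, a⟩, hp, rfl⟩ := mem_map.1 hv
    simp only [mem_product, mem_singleton] at hp
    obtain ⟨rfl, -⟩ := hp
    exact (ψ j a).2

theorem isFree_forbidden_iff (H : RGraph 3 V) (s : ℕ) :
    H.IsFree (forbidden s) ↔ NoF5 H.edges ∧
      ∀ M ⊆ H.edges, (M : Set (Finset V)).PairwiseDisjoint id → M.card ≤ s := by
  have h1 : H.IsFree (forbidden s) ↔ ¬ H.Contains F5 ∧ ¬ H.Contains (matching 3 (s + 1)) := by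
    simp [IsFree, forbidden]
  rw [h1, contains_F5_iff, not_not, contains_matching_iff]
  refine and_congr_right fun _ => ⟨fun h M hM hd => ?_, ?_⟩
  · by_contra! hlt
    obtain ⟨M', hM', hc⟩ := exists_subset_card_eq (Nat.succ_le_of_lt hlt)
    exact h ⟨M', hM'.trans hM, hd.subset (coe_subset.2 hM'), hc⟩
  · rintro h ⟨M, hM, hd, hc⟩
    have := h M hM hd
    omega

end Containment

/-! ### Invariance under isomorphism. -/

section Isomorphism

variable {r : ℕ} {V W : Type}

theorem IsIsomorphic.symm {H : RGraph r V} {H' : RGraph r W} (h : H.IsIsomorphic H') :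
    H'.IsIsomorphic H := by
  obtain ⟨φ, hφ⟩ := h
  refine ⟨φ.symm, fun e => ?_⟩
  rw [hφ, map_map]
  simp

theorem IsIsomorphic.contains {X : Type} {H : RGraph r V} {H' : RGraph r W} {F : RGraph r X}
    (h : H.IsIsomorphic H') (hF : H.Contains F) : H'.Contains F := by
  obtain ⟨φ, hφ⟩ := h
  obtain ⟨f, hf⟩ := hF
  refine ⟨f.trans φ.toEmbedding, fun e he => ?_⟩
  rw [← map_map]
  exact (hφ _).1 (hf e he)

theorem IsIsomorphic.isFree {ℱ : Set (Σ W : Type, RGraph r W)} {H : RGraph r V} {H' : RGraph r W}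
    (h : H.IsIsomorphic H') (hH : H'.IsFree ℱ) : H.IsFree ℱ :=
  fun F hF hc => hH F hF (h.contains hc)

theorem IsIsomorphic.card_eq {H : RGraph r V} {H' : RGraph r W} (h : H.IsIsomorphic H') :
    H.edges.card = H'.edges.card := by
  have key : ∀ {V W : Type} {H : RGraph r V} {H' : RGraph r W}, H.IsIsomorphic H' →
      H.edges.card ≤ H'.edges.card := by
    rintro V W H H' ⟨φ, hφ⟩
    exact card_le_card_of_injOn (fun e => e.map φ.toEmbedding) (fun e he => (hφ e).1 he)
      (map_injective _).injOn
  exact le_antisymm (key h) (key h.symm)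

end Isomorphism

/-! ### The extremal systems: freeness, edge counts and uniqueness. -/

section Extremal

theorem completePartite_edges {V : Type} [Fintype V] [DecidableEq V] (c : V → Fin 3) :
    (completePartite 3 c).edges = rainbow c := by
  ext e
  simp only [completePartite, rainbow, mem_filter, mem_powersetCard_univ, Set.InjOn, mem_coe]

theorem completePartite_isIsomorphic {V W : Type} [Fintype V] [Fintype W] [DecidableEq V]
    [DecidableEq W] {c : V → Fin 3} {c' : W → Fin 3}
    (h : ∀ i, (univ.filter fun x => c x = i).card = (univ.filter fun x => c' x = i).card) :
    (completePartite 3 c).IsIsomorphic (completePartite 3 c') := by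
  have e : ∀ i, {a // c a = i} ≃ {b // c' b = i} := fun i =>
    Fintype.equivOfCardEq (by rw [Fintype.card_subtype, Fintype.card_subtype, h i])
  refine ⟨Equiv.ofFiberEquiv e, fun t => ?_⟩
  have hc : ∀ x, c' (Equiv.ofFiberEquiv e x) = c x := Equiv.ofFiberEquiv_map e
  simp only [completePartite_edges, rainbow, mem_filter, mem_powersetCard_univ, card_map]
  simp only [mem_map_equiv, Equiv.forall_congr_left (Equiv.ofFiberEquiv e).symm, Equiv.symm_symm,
    Equiv.symm_apply_apply, hc, EmbeddingLike.apply_eq_iff_eq]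

/-- The vertices a, b, u, v of a copy are pairwise together in an edge, so they would need four
colours. -/
theorem noF5_rainbow {V : Type} [Fintype V] [DecidableEq V] (c : V → Fin 3) :
    NoF5 (rainbow c) := by
  intro a b u v e h1 h2 h3
  exfalso
  simp only [rainbow, mem_filter, mem_powersetCard_univ] at h1 h2 h3
  obtain ⟨hab, hau, hbu⟩ := ne_of_triple_card h1.1
  obtain ⟨-, hav, hbv⟩ := ne_of_triple_card h2.1
  obtain ⟨huv, -, -⟩ := ne_of_triple_card h3.1
  have h4 : c a ≠ c b := fun h => hab (h1.2 a (by simp) b (by simp) h)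
  have h5 : c a ≠ c u := fun h => hau (h1.2 a (by simp) u (by simp) h)
  have h6 : c b ≠ c u := fun h => hbu (h1.2 b (by simp) u (by simp) h)
  have h7 : c a ≠ c v := fun h => hav (h2.2 a (by simp) v (by simp) h)
  have h8 : c b ≠ c v := fun h => hbv (h2.2 b (by simp) v (by simp) h)
  have h9 : c u ≠ c v := fun h => huv (h3.2 u (by simp) v (by simp) h)
  omega

/-- Each edge has a vertex of colour 0, and disjoint edges have different ones. -/
theorem card_matching_rainbow_le {V : Type} [Fintype V] [DecidableEq V] (c : V → Fin 3)
    {M : Finset (Finset V)} (hM : M ⊆ rainbow c) (hd : (M : Set (Finset V)).PairwiseDisjoint id) :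
    M.card ≤ (univ.filter fun x => c x = 0).card := by
  have hex : ∀ e ∈ M, ∃ x ∈ e, c x = 0 := by
    intro e he
    obtain ⟨h1, h2⟩ := mem_filter.1 (hM he)
    obtain ⟨x, a, b, hx, -, -, rfl⟩ := exists_triple_of_injective (mem_powersetCard_univ.1 h1) h2
      (i := 1) (j := 2) (by decide) (by decide) (by decide)
    exact ⟨x, by simp, hx⟩
  choose f hf using hex
  rw [← card_attach]
  refine card_le_card_of_injOn (fun e => f e.1 e.2) (fun e _ => by simpa using (hf e.1 e.2).2) ?_
  intro e _ e' _ h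
  by_contra hne
  exact disjoint_left.1 (hd e.2 e'.2 fun h => hne (Subtype.ext h)) (hf e.1 e.2).1
    (by rw [show f e.1 e.2 = f e'.1 e'.2 from h]; exact (hf e'.1 e'.2).1)

theorem card_rainbow {V : Type} [Fintype V] [DecidableEq V] (c : V → Fin 3) :
    (rainbow c).card = (univ.filter fun x => c x = 0).card *
      ((univ.filter fun x => c x = 1).card * (univ.filter fun x => c x = 2).card) := by
  rw [← card_product, ← card_product]
  symm
  refine card_nbij (fun p => {p.1, p.2.1, p.2.2}) ?_ ?_ ?_
  · rintro ⟨x, a, b⟩ h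
    simp only [coe_product, Set.mem_prod, mem_coe, mem_filter, mem_univ, true_and] at h
    obtain ⟨hx, ha, hb⟩ := h
    have hxa : c x ≠ c a := by rw [hx, ha]; decide
    have hxb : c x ≠ c b := by rw [hx, hb]; decide
    have hab : c a ≠ c b := by rw [ha, hb]; decide
    refine mem_filter.2 ⟨mem_powersetCard_univ.2 (card_eq_three.2 ⟨x, a, b, fun h => hxa (h ▸ rfl),
      fun h => hxb (h ▸ rfl), fun h => hab (h ▸ rfl), rfl⟩), ?_⟩
    simp only [mem_insert, mem_singleton]
    rintro y hy z hz hyz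
    rcases hy with rfl | rfl | rfl <;> rcases hz with rfl | rfl | rfl <;>
      first | rfl | exact absurd hyz ‹_› | exact absurd hyz.symm ‹_›
  · rintro ⟨x, a, b⟩ h ⟨x', a', b'⟩ h' heq
    simp only [coe_product, Set.mem_prod, mem_coe, mem_filter, mem_univ, true_and] at h h' heq
    obtain ⟨hx, ha, hb⟩ := h
    obtain ⟨hx', ha', hb'⟩ := h'
    have key : ∀ t ∈ ({x', a', b'} : Finset V), (c t = 0 → t = x') ∧ (c t = 1 → t = a') ∧
        (c t = 2 → t = b') := by
      intro t ht
      simp only [mem_insert, mem_singleton] at ht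
      rcases ht with rfl | rfl | rfl <;> simp_all
    have h1 := (key x (heq ▸ by simp)).1 hx
    have h2 := (key a (heq ▸ by simp)).2.1 ha
    have h3 := (key b (heq ▸ by simp)).2.2 hb
    rw [h1, h2, h3]
  · intro e he
    obtain ⟨h1, h2⟩ := mem_filter.1 he
    obtain ⟨x, a, b, hx, ha, hb, rfl⟩ := exists_triple_of_injective (mem_powersetCard_univ.1 h1) h2
      (i := 1) (j := 2) (by decide) (by decide) (by decide)
    exact ⟨(x, a, b), by simp [hx, ha, hb], rfl⟩

theorem half_mul_half (N : ℕ) : N / 2 * (N - N / 2) = N ^ 2 / 4 := by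
  rcases Nat.even_or_odd' N with ⟨k, rfl | rfl⟩
  · rw [show (2 * k) ^ 2 = 4 * (k ^ 2) by ring, Nat.mul_div_cancel_left _ (by norm_num),
      Nat.mul_div_cancel_left _ (by norm_num), show 2 * k - k = k by omega, sq]
  · rw [show (2 * k + 1) ^ 2 = 1 + 4 * (k ^ 2 + k) by ring, Nat.add_mul_div_left _ _ (by norm_num),
      show (2 * k + 1) / 2 = k by omega, show 2 * k + 1 - k = k + 1 by omega]
    norm_num
    ring

/-- The colouring that defines `H3 n s`. -/
def H3colour (n s : ℕ) (i : Fin n) : Fin 3 :=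
  if i.val < s then 0 else if i.val < s + (n - s) / 2 then 1 else 2

theorem card_filter_fin_val (n : ℕ) (p : ℕ → Prop) [DecidablePred p] :
    (univ.filter fun i : Fin n => p i.val).card = ((range n).filter p).card := by
  rw [← card_map Fin.valEmbedding]
  congr 1
  ext k
  simp only [mem_map, mem_filter, mem_univ, true_and, Fin.valEmbedding_apply, mem_range]
  exact ⟨fun ⟨i, hi, hk⟩ => hk ▸ ⟨i.2, hi⟩, fun ⟨h1, h2⟩ => ⟨⟨k, h1⟩, h2, rfl⟩⟩

theorem card_H3colour {n s : ℕ} (h : s ≤ n) :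
    (univ.filter fun i => H3colour n s i = 0).card = s ∧
      (univ.filter fun i => H3colour n s i = 1).card = (n - s) / 2 ∧
      (univ.filter fun i => H3colour n s i = 2).card = n - s - (n - s) / 2 := by
  have h0 : ∀ i : Fin n, H3colour n s i = 0 ↔ i.val < s := by
    intro i
    unfold H3colour
    split_ifs <;> simp_all
  have h1 : ∀ i : Fin n, H3colour n s i = 1 ↔ s ≤ i.val ∧ i.val < s + (n - s) / 2 := by
    intro i
    unfold H3colour
    split_ifs <;> simp <;> omega
  have h2 : ∀ i : Fin n, H3colour n s i = 2 ↔ s + (n - s) / 2 ≤ i.val := by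
    intro i
    unfold H3colour
    split_ifs <;> simp <;> omega
  simp only [h0, h1, h2]
  rw [card_filter_fin_val n (fun k => k < s),
    card_filter_fin_val n (fun k => s ≤ k ∧ k < s + (n - s) / 2),
    card_filter_fin_val n (fun k => s + (n - s) / 2 ≤ k)]
  refine ⟨?_, ?_, ?_⟩
  · rw [show (range n).filter (fun k => k < s) = range s by ext; simp; omega, card_range]
  · rw [show (range n).filter (fun k => s ≤ k ∧ k < s + (n - s) / 2) = Ico s (s + (n - s) / 2) by
      ext; simp; omega, Nat.card_Ico]
    omega
  · rw [show (range n).filter (fun k => s + (n - s) / 2 ≤ k) = Ico (s + (n - s) / 2) n by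
      ext; simp; omega, Nat.card_Ico]
    omega

theorem H3_edges (n s : ℕ) : (H3 n s).edges = rainbow (H3colour n s) := completePartite_edges _

theorem isFree_H3 {n s : ℕ} (h : s ≤ n) : (H3 n s).IsFree (forbidden s) := by
  rw [isFree_forbidden_iff, H3_edges]
  exact ⟨noF5_rainbow _, fun M hM hd =>
    (card_matching_rainbow_le _ hM hd).trans (card_H3colour h).1.le⟩

theorem card_H3 {n s : ℕ} (h : s ≤ n) : (H3 n s).edges.card = s * ((n - s) ^ 2 / 4) := by
  rw [H3_edges, ← half_mul_half, card_rainbow, (card_H3colour h).1, (card_H3colour h).2.1,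
    (card_H3colour h).2.2]

theorem isIsomorphic_H3_of_large {n s : ℕ} (hs : 3 ≤ s) (hn : 30 * (s + 1) ≤ n)
    {H : RGraph 3 (Fin n)} (hH : H.IsFree (forbidden s))
    (hlarge : s * ((n - s) ^ 2 / 4) ≤ H.edges.card) : H.IsIsomorphic (H3 n s) := by
  obtain ⟨hF, hν⟩ := (isFree_forbidden_iff H s).1 hH
  obtain ⟨c, hc, h0, h1, h2⟩ := rainbow_of_large H.uniform hF hν hs (by simpa using hn)
    (by simpa using hlarge)
  rw [Fintype.card_fin] at h1 h2
  obtain ⟨g0, g1, g2⟩ := card_H3colour (n := n) (s := s) (by omega)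
  have hiso : (completePartite 3 c).IsIsomorphic (completePartite 3 (H3colour n s)) := by
    refine completePartite_isIsomorphic fun i => ?_
    fin_cases i
    · exact h0.trans g0.symm
    · exact h1.trans g1.symm
    · exact h2.trans g2.symm
  have : H = completePartite 3 c := RGraph.ext (by rw [hc, completePartite_edges])
  rw [this]
  exact hiso

theorem card_fullStar {V : Type} [Fintype V] [DecidableEq V] (x : V) :
    (fullStar 3 x).edges.card = (Fintype.card V - 1).choose 2 := by
  rw [← card_univ, ← card_erase_of_mem (mem_univ x), ← card_powersetCard]
  refine card_bij' (fun e _ => e.erase x) (fun e _ => insert x e) ?_ ?_ ?_ ?_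
  · intro e he
    obtain ⟨h1, h2⟩ := mem_filter.1 he
    rw [mem_powersetCard_univ] at h1
    exact mem_powersetCard.2 ⟨erase_subset_erase _ (subset_univ _), by
      rw [card_erase_of_mem h2, h1]⟩
  · intro e he
    obtain ⟨h1, h2⟩ := mem_powersetCard.1 he
    have hx : x ∉ e := fun h => by simpa using h1 h
    exact mem_filter.2 ⟨mem_powersetCard_univ.2 (by rw [card_insert_of_notMem hx, h2]),
      mem_insert_self _ _⟩
  · intro e he
    exact insert_erase (mem_filter.1 he).2
  · intro e he
    have hx : x ∉ e := fun h => by simpa using (mem_powersetCard.1 he).1 h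
    exact erase_insert hx

theorem isFree_fullStar {V : Type} [Fintype V] [DecidableEq V] (x : V) {s : ℕ} (hs : 1 ≤ s) :
    (fullStar 3 x).IsFree (forbidden s) := by
  have hx : ∀ e ∈ (fullStar 3 x).edges, x ∈ e := fun e he => (mem_filter.1 he).2
  rw [isFree_forbidden_iff]
  constructor
  · intro a b c d e h1 h2 h3
    obtain ⟨-, hac, hbc⟩ := ne_of_triple_card ((fullStar 3 x).uniform _ h1)
    obtain ⟨-, had, hbd⟩ := ne_of_triple_card ((fullStar 3 x).uniform _ h2)
    obtain ⟨hcd, -, -⟩ := ne_of_triple_card ((fullStar 3 x).uniform _ h3)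
    have h1' := hx _ h1
    have h2' := hx _ h2
    have h3' := hx _ h3
    simp only [mem_insert, mem_singleton] at h1' h2' h3'
    rcases h3' with rfl | rfl | rfl
    · rcases h2' with h | h | h
      · exact absurd h.symm hac
      · exact absurd h.symm hbc
      · exact absurd h hcd
    · rcases h1' with h | h | h
      · exact absurd h.symm had
      · exact absurd h.symm hbd
      · exact absurd h.symm hcd
    · rcases h1' with h | h | h
      · exact Or.inl h
      · exact Or.inr h
      · exact absurd h.symm (ne_of_triple_card ((fullStar 3 x).uniform _ h3)).2.1
  · intro M hM hd
    refine (card_le_one.2 fun e he f hf => ?_).trans hs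
    by_contra hne
    exact disjoint_left.1 (hd he hf hne) (hx e (hM he)) (hx f (hM hf))

theorem eq_fullStar_of_large {n s : ℕ} (hs : s = 1 ∨ s = 2) (hn : 30 * (s + 1) ≤ n)
    {H : RGraph 3 (Fin n)} (hH : H.IsFree (forbidden s))
    (hlarge : (n - 1).choose 2 ≤ H.edges.card) : ∃ x, H = fullStar 3 x := by
  obtain ⟨hF, hν⟩ := (isFree_forbidden_iff H s).1 hH
  obtain ⟨x, hx⟩ := star_of_large H.uniform hF hs hν (by simpa using hn) (by simpa using hlarge)
  refine ⟨x, RGraph.ext (eq_of_subset_of_card_le (fun e he => ?_) ?_)⟩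
  · exact mem_filter.2 ⟨mem_powersetCard_univ.2 (H.uniform e he), hx e he⟩
  · rw [card_fullStar, Fintype.card_fin]
    exact hlarge

/-- The second hypothesis is phrased for systems with at least m edges because the structure
theorems take that form. It makes m a greatest element, so the supremum in ℕ is genuine and not the
default 0 of an unbounded set. -/
theorem turanNumber_eq {r n m : ℕ} {ℱ : Set (Σ W : Type, RGraph r W)}
    (h1 : ∃ H : RGraph r (Fin n), H.IsFree ℱ ∧ H.edges.card = m)
    (h2 : ∀ H : RGraph r (Fin n), H.IsFree ℱ → m ≤ H.edges.card → H.edges.card = m) :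
    turanNumber r n ℱ = m := by
  refine IsGreatest.csSup_eq ⟨h1, ?_⟩
  rintro _ ⟨H, hH, rfl⟩
  by_contra! hlt
  exact absurd (h2 H hH hlt.le) hlt.ne'

end Extremal

end RGraph

theorem mainTheorem1 (n s : ℕ) (hn : 30 * (s + 1) ≤ n) :
    ((s = 1 ∨ s = 2) →
      RGraph.turanNumber 3 n (RGraph.forbidden s) = (n - 1).choose 2 ∧
      ∀ H : RGraph 3 (Fin n),
        (H.IsFree (RGraph.forbidden s) ∧
            H.edges.card = RGraph.turanNumber 3 n (RGraph.forbidden s)) ↔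
          ∃ x : Fin n, H = RGraph.fullStar 3 x) ∧
    (3 ≤ s →
      RGraph.turanNumber 3 n (RGraph.forbidden s) = s * ((n - s) ^ 2 / 4) ∧
      ∀ H : RGraph 3 (Fin n),
        (H.IsFree (RGraph.forbidden s) ∧
            H.edges.card = RGraph.turanNumber 3 n (RGraph.forbidden s)) ↔
          H.IsIsomorphic (RGraph.H3 n s)) := by
  refine ⟨fun hs => ?_, fun hs => ?_⟩
  · have hcard : ∀ x : Fin n, (RGraph.fullStar 3 x).edges.card = (n - 1).choose 2 := fun x => by
      rw [RGraph.card_fullStar, Fintype.card_fin]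
    have hfree : ∀ x : Fin n, (RGraph.fullStar 3 x).IsFree (RGraph.forbidden s) :=
      fun x => RGraph.isFree_fullStar x (by omega)
    have hT : RGraph.turanNumber 3 n (RGraph.forbidden s) = (n - 1).choose 2 := by
      refine RGraph.turanNumber_eq ⟨_, hfree ⟨0, by omega⟩, hcard _⟩ fun H hH hlarge => ?_
      obtain ⟨x, rfl⟩ := RGraph.eq_fullStar_of_large hs hn hH hlarge
      exact hcard x
    refine ⟨hT, fun H => ⟨fun h => ?_, ?_⟩⟩
    · exact RGraph.eq_fullStar_of_large hs hn h.1 (h.2.trans hT).ge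
    · rintro ⟨x, rfl⟩
      exact ⟨hfree x, (hcard x).trans hT.symm⟩
  · have hsn : s ≤ n := by omega
    have hfree := RGraph.isFree_H3 hsn
    have hcard := RGraph.card_H3 hsn
    have hT : RGraph.turanNumber 3 n (RGraph.forbidden s) = s * ((n - s) ^ 2 / 4) :=
      RGraph.turanNumber_eq ⟨_, hfree, hcard⟩ fun H hH hlarge =>
        (RGraph.isIsomorphic_H3_of_large hs hn hH hlarge).card_eq.trans hcard
    refine ⟨hT, fun H => ⟨fun h => ?_, fun h => ?_⟩⟩
    · exact RGraph.isIsomorphic_H3_of_large hs hn h.1 (h.2.trans hT).ge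
    · exact ⟨h.isFree hfree, (h.card_eq.trans hcard).trans hT.symm⟩
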